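/- Let $d\ge 3$. Let $S=(S_t)_{t\ge 0}$ be a subordinator (a Lévy process with values in $[0,\infty)$, $S_0=0$) with Laplace exponent $\phi(\lambda)=\frac{\lambda}{\ln(1+\lambda)}-1$, i.e. $\mathbb E\,e^{-\lambda S_t}=e^{-t\phi(\lambda)}$ for $\lambda>0$, $t\ge 0$, and let $U(A)=\mathbb E\left[\int_0^\infty 1_{\{S_t\in A\}}\,dt\right]$ be its potential measure. Let $B=(B_t)_{t\ge 0}$ be a Brownian motion in $\mathbb R^d$ started at $0$, independent of $S$ and normalized by $\mathbb E\,e^{i\xi\cdot B_t}=e^{-t|\xi|^2}$, and let $X_t=B_{S_t}$ be the corresponding subordinate Brownian motion (a Lévy process with characteristic exponent $\Phi(\xi)=\frac{|\xi|^2}{\ln(1+|\xi|^2)}-1$); the process started at $x\in\mathbb R^d$ is $x+X_t$. Put $$g(r)=(4\pi)^{-d/2}\int_{(0,\infty)}t^{-d/2}e^{-r^2/(4t)}\,U(dt),\qquad r>0 .$$ Then $g(r)<\infty$ for all $r>0$, and $G(x,y)=g(|x-y|)$ (where $g(0)\in[0,\infty]$ is given by the same formula) is the Green function of $X$: the process has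 a transition density $p(t,x,y)$, $t>0$, continuous in $y$, such that $G(x,y)=\int_0^\infty p(t,x,y)\,dt$ for all $x,y\in\mathbb R^d$, and $\mathbb E\left[\int_0^\infty 1_{\{x+X_t\in A\}}\,dt\right]=\int_A G(x,y)\,dy$ for every $x\in\mathbb R^d$ and every Borel set $A\subset\mathbb R^d$. Moreover $$g(r)\sim\frac{\Gamma(\frac d2-1)}{2\pi^{d/2}}\,r^{2-d}\,\ln\frac1r\quad\text{as } r\to 0+,\qquad g(r)\sim\frac{\Gamma(\frac d2-1)}{2\pi^{d/2}}\,r^{2-d}\quad\text{as } r\to\infty .$$ -/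

import Mathlib

open MeasureTheory ProbabilityTheory Filter Set
open scoped NNReal ENNReal Topology

noncomputable section

namespace GreenAsymp

/-- The state space `ℝ^d` with its Euclidean norm. -/
abbrev E (d : ℕ) : Type := EuclideanSpace ℝ (Fin d)

/-- A Lévy process started at `0`, with time set `[0, ∞)`: it has independent and stationary
increments and almost surely right-continuous paths with left limits.
(At `t = 0` the left limit condition is void.) -/
structure IsLevy {Ω F : Type*} [MeasurableSpace Ω] [AddCommGroup F] [TopologicalSpace F]
    [MeasurableSpace F] (X : ℝ≥0 → Ω → F) (P : Measure Ω) : Prop where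
  measurable : ∀ t, Measurable (X t)
  zero : ∀ᵐ ω ∂P, X 0 ω = 0
  indep : HasIndepIncrements X P
  stationary : ∀ s t, P.map (fun ω => X (s + t) ω - X s ω) = P.map (X t)
  cadlag : ∀ᵐ ω ∂P, ∀ t, ContinuousWithinAt (fun s => X s ω) (Ici t) t ∧
    ∃ l, Tendsto (fun s => X s ω) (𝓝[<] t) (𝓝 l)

/-- A subordinator: a real Lévy process started at `0` that takes values in `[0, ∞)`. -/
structure IsSubordinator {Ω : Type*} [MeasurableSpace Ω] (S : ℝ≥0 → Ω → ℝ) (P : Measure Ω) :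
    Prop extends IsLevy S P where
  nonneg : ∀ t ω, 0 ≤ S t ω

/-- `φ` is the Laplace exponent of `S`: `𝔼 exp (-λ S_t) = exp (-t φ(λ))` for `λ > 0`, `t ≥ 0`. -/
def HasLaplaceExponent {Ω : Type*} [MeasurableSpace Ω] (S : ℝ≥0 → Ω → ℝ) (P : Measure Ω)
    (φ : ℝ → ℝ) : Prop :=
  ∀ (t : ℝ≥0) (l : ℝ), 0 < l → ∫ ω, Real.exp (-l * S t ω) ∂P = Real.exp (-(t : ℝ) * φ l)

/-- The Laplace exponent `φ(λ) = λ / ln (1 + λ) - 1`. -/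
def phi (l : ℝ) : ℝ := l / Real.log (1 + l) - 1

/-- Brownian motion in `ℝ^d` started at `0`, with the normalization
`𝔼 exp (i ξ · B_t) = exp (-t |ξ|²)`: the coordinates are independent, and each of them
is `√2` times a standard real Brownian motion. -/
structure IsBrownian {Ω : Type*} [MeasurableSpace Ω] {d : ℕ} (B : ℝ≥0 → Ω → E d)
    (P : Measure Ω) : Prop where
  measurable : ∀ t, Measurable (B t)
  coord : ∀ i : Fin d, IsBrownianReal (fun t ω => (Real.sqrt 2)⁻¹ * B t ω i) P
  indep : iIndepFun (fun (i : Fin d) (ω : Ω) (t : ℝ≥0) => B t ω i) P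

/-- The subordinate process `X_t = B_{S_t}`. -/
def subordinate {Ω F : Type*} (B : ℝ≥0 → Ω → F) (S : ℝ≥0 → Ω → ℝ) : ℝ≥0 → Ω → F :=
  fun t ω => B (S t ω).toNNReal ω

/-- The potential (occupation) measure `A ↦ 𝔼 ∫_0^∞ 1_{Y_t ∈ A} dt` of a process `Y`, as the
image of `P ⊗ dt` under `(ω, t) ↦ Y_t(ω)`; see `potentialMeasure_apply`. -/
def potentialMeasure {Ω F : Type*} [MeasurableSpace Ω] [MeasurableSpace F]
    (Y : ℝ≥0 → Ω → F) (P : Measure Ω) : Measure F :=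
  (P.prod (volume.restrict (Ioi (0 : ℝ)))).map (fun q => Y q.2.toNNReal q.1)

theorem potentialMeasure_apply {Ω F : Type*} [MeasurableSpace Ω] [MeasurableSpace F]
    (Y : ℝ≥0 → Ω → F) (P : Measure Ω)
    (hY : AEMeasurable (fun q : Ω × ℝ => Y q.2.toNNReal q.1)
      (P.prod (volume.restrict (Ioi (0 : ℝ)))))
    (A : Set F) (hA : MeasurableSet A) :
    potentialMeasure Y P A =
      ∫⁻ ω, (∫⁻ t in Ioi (0 : ℝ), A.indicator (1 : F → ℝ≥0∞) (Y t.toNNReal ω)) ∂P := by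
  have h1 : potentialMeasure Y P A = ∫⁻ y, A.indicator 1 y ∂(potentialMeasure Y P) := by
    rw [lintegral_indicator_one hA]
  have hm : Measurable (A.indicator (1 : F → ℝ≥0∞)) := measurable_one.indicator hA
  rw [h1, potentialMeasure, lintegral_map' hm.aemeasurable hY, lintegral_prod]
  exact hm.comp_aemeasurable hY

/-- The function `g(r) = (4π)^{-d/2} ∫_{(0,∞)} t^{-d/2} exp (-r² / (4t)) U(dt)`, with values in
`[0, ∞]`. -/
def greenRadial (d : ℕ) (U : Measure ℝ) (r : ℝ) : ℝ≥0∞ :=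
  ENNReal.ofReal ((4 * Real.pi) ^ (-(d : ℝ) / 2)) *
    ∫⁻ t in Ioi (0 : ℝ), ENNReal.ofReal (t ^ (-(d : ℝ) / 2) * Real.exp (-r ^ 2 / (4 * t))) ∂U

/-- `p` is the (unique) transition density of the process `x + X_t` that is continuous in the
end point: for all `t > 0` and all starting points `x`, the law of `x + X_t` is
`p(t, x, y) dy`. -/
def IsTransitionDensity {Ω : Type*} [MeasurableSpace Ω] {d : ℕ} (X : ℝ≥0 → Ω → E d)
    (P : Measure Ω) (p : ℝ≥0 → E d → E d → ℝ≥0) : Prop :=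
  ∀ t : ℝ≥0, 0 < t → ∀ x : E d, Continuous (p t x) ∧
    P.map (fun ω => x + X t ω) = volume.withDensity (fun y => (p t x y : ℝ≥0∞))

/-- `G` is the Green function of `X`: `G(x, y) = ∫_0^∞ p(t, x, y) dt` for the transition density
`p`, and `G(x, ·)` is a density of the potential measure of the process started at `x`. -/
def IsGreenFunction {Ω : Type*} [MeasurableSpace Ω] {d : ℕ} (X : ℝ≥0 → Ω → E d)
    (P : Measure Ω) (G : E d → E d → ℝ≥0∞) : Prop :=
  (∃ p : ℝ≥0 → E d → E d → ℝ≥0, IsTransitionDensity X P p ∧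
    ∀ x y, G x y = ∫⁻ t in Ioi (0 : ℝ), (p t.toNNReal x y : ℝ≥0∞)) ∧
  ∀ x, potentialMeasure (fun t ω => x + X t ω) P = volume.withDensity (G x)

end GreenAsymp

end

/-!
The Green function is the heat kernel integrated against the potential measure `U` of the
subordinator, and everything about `U` is read off its Laplace transform, which is the reciprocal
`1 / phi s = log (1 + s) / (s - log (1 + s))` of the Laplace exponent (`lap_potentialMeasure`).

*Asymptotics.* By scaling, `g r` is `(4π)^{-d/2} r^{2-d} q(r)` times the integral of
`t^{-d/2} e^{-1/(4t)}` against the measure obtained from `U` by the map `t ↦ t / r ^ 2` and division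
by `r ^ 2 * q r`. With `q r = 2 log (1 / r)` for `r → 0` and `q r = 2` for `r → ∞`, elementary
estimates of the logarithm show that the Laplace transforms of these measures converge to `1 / s`,
that of Lebesgue measure, and stay below a multiple of `1 + 1 / s`. The Tauberian theorem
`tendsto_integral_of_tendsto_lap` turns this into convergence of the integrals, and the limit is a
Gamma integral. Its proof is Karamata's, with a weight in place of truncations: `(1 + t)^{-5/4}` is
a mixture of the functions `e^{-st}`, so the measures with this density have convergent moments in
the variable `x = e^{-t} ∈ [0, 1]`, and Weierstrass approximation gives the convergence of integrals
of all continuous functions of `x`. For `d ≥ 3` the quotient of `t^{-d/2} e^{-1/(4t)}` by the weight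
is such a function, since it vanishes at `0` and at `∞`.

*Green function.* As `B` is continuous and independent of `S`, the law of `B` at time `S t` is the
law of `B s` averaged over the law of `s = S t`; this is obtained by discretizing the random time
(`lintegral_eval_of_indepFun`). Since `S t > 0` almost surely, the averaged heat kernel is a
transition density. It is bounded and continuous because `phi s` grows at least like `√s / 2`, so
that `S t` has finite negative moments (`lintegral_rpow_neg_lt_top`). Tonelli's theorem then
identifies the time integral of the density with `g`, and `g` with the density of the potential
measure.
-/

noncomputable section

namespace GreenAsymp

/-! ### A continuity theorem for Laplace transforms of infinite measures -/

/-- Convergence of moments on `[0, 1]` implies convergence of integrals of continuous functions,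
by Weierstrass approximation. -/
theorem tendsto_integral_of_tendsto_moments {ι : Type*} {l : Filter ι} {m : ι → Measure ℝ}
    {m₀ : Measure ℝ} [IsFiniteMeasure m₀] (hfin : ∀ᶠ i in l, IsFiniteMeasure (m i))
    (hm : ∀ i, ∀ᵐ x ∂(m i), x ∈ Icc (0 : ℝ) 1) (hm₀ : ∀ᵐ x ∂m₀, x ∈ Icc (0 : ℝ) 1)
    (hmom : ∀ k : ℕ, Tendsto (fun i => ∫ x, x ^ k ∂(m i)) l (𝓝 (∫ x, x ^ k ∂m₀)))
    {H : ℝ → ℝ} (hH : ContinuousOn H (Icc 0 1)) :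
    Tendsto (fun i => ∫ x, H x ∂(m i)) l (𝓝 (∫ x, H x ∂m₀)) := by
  have hint : ∀ (μ : Measure ℝ) [IsFiniteMeasure μ], (∀ᵐ x ∂μ, x ∈ Icc (0 : ℝ) 1) →
      ∀ F : ℝ → ℝ, ContinuousOn F (Icc 0 1) → Integrable F μ := by
    intro μ _ hμ F hF
    have := hF.integrableOn_Icc (μ := μ)
    rwa [IntegrableOn, Measure.restrict_eq_self_of_ae_mem hμ] at this
  have hmass : ∀ᶠ i in l, (m i).real univ < m₀.real univ + 1 := by
    have h0 := hmom 0
    simp only [pow_zero, integral_const, smul_eq_mul, mul_one] at h0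
    exact h0.eventually_lt_const (by linarith)
  have hpoly : ∀ p : Polynomial ℝ,
      Tendsto (fun i => ∫ x, p.eval x ∂(m i)) l (𝓝 (∫ x, p.eval x ∂m₀)) := by
    intro p
    have hsum : ∀ (μ : Measure ℝ) [IsFiniteMeasure μ], (∀ᵐ x ∂μ, x ∈ Icc (0 : ℝ) 1) →
        ∫ x, p.eval x ∂μ = ∑ k ∈ p.support, p.coeff k * ∫ x, x ^ k ∂μ := by
      intro μ _ hμ
      simp_rw [Polynomial.eval_eq_sum, Polynomial.sum]
      rw [integral_finsetSum]
      · simp_rw [integral_const_mul]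
      · intro k _
        exact hint μ hμ _ (by fun_prop)
    rw [hsum m₀ hm₀]
    refine (tendsto_finsetSum p.support
      (fun k _ => (hmom k).const_mul (p.coeff k))).congr' ?_
    filter_upwards [hfin] with i hi
    exact (hsum (m i) (hm i)).symm
  rw [Metric.tendsto_nhds]
  intro ε hε
  set M := m₀.real univ + 1 with hM
  have hM0 : 0 < M := by positivity
  obtain ⟨p, hp⟩ := exists_polynomial_near_of_continuousOn 0 1 H hH (ε / (3 * M)) (by positivity)
  have hdiff : ∀ (μ : Measure ℝ) [IsFiniteMeasure μ], (∀ᵐ x ∂μ, x ∈ Icc (0 : ℝ) 1) →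
      μ.real univ ≤ M → |∫ x, p.eval x ∂μ - ∫ x, H x ∂μ| ≤ ε / 3 := by
    intro μ _ hμ hle
    rw [← integral_sub (hint μ hμ _ (by fun_prop)) (hint μ hμ _ hH), ← Real.norm_eq_abs]
    refine (norm_integral_le_of_norm_le_const (C := ε / (3 * M)) ?_).trans ?_
    · filter_upwards [hμ] with x hx
      exact (hp x hx).le
    · calc ε / (3 * M) * μ.real univ ≤ ε / (3 * M) * M := by gcongr
        _ = ε / 3 := by field_simp
  filter_upwards [hfin, hmass, Metric.tendsto_nhds.1 (hpoly p) (ε / 3) (by positivity)]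
    with i hi hmi hpi
  have h1 := hdiff (m i) (hm i) hmi.le
  have h2 := hdiff m₀ hm₀ (by linarith)
  rw [Real.dist_eq] at hpi ⊢
  rw [abs_le] at h1 h2
  rw [abs_lt] at hpi ⊢
  constructor <;> linarith [h1.1, h1.2, h2.1, h2.2, hpi.1, hpi.2]

/-- The Laplace transform of a measure on the line, with values in `[0, ∞]`. -/
def lap (μ : Measure ℝ) (l : ℝ) : ℝ≥0∞ := ∫⁻ t, ENNReal.ofReal (Real.exp (-l * t)) ∂μ

/-- The weight `(1 + t)^{-5/4}`. Any exponent `-a` with `1 < a < 3 / 2` would do: `1 < a` makes the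
weight integrable against measures that grow like Lebesgue measure, and `a < 3 / 2 ≤ d / 2` makes
it dominate the heat kernel as a function of time. -/
def wt (t : ℝ) : ℝ := (1 + t) ^ (-(5 / 4) : ℝ)

/-- The Gamma density with parameter `5 / 4`, whose Laplace transform is `wt`. -/
def wtDensity (l : ℝ) : ℝ := (Real.Gamma (5 / 4))⁻¹ * (Real.exp (-l) * l ^ ((5 / 4 : ℝ) - 1))

theorem measurable_wt : Measurable wt := by unfold wt; fun_prop

theorem measurable_wtDensity : Measurable wtDensity := by unfold wtDensity; fun_prop

theorem measurable_lap (μ : Measure ℝ) [SFinite μ] : Measurable (lap μ) := by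
  unfold lap
  refine Measurable.lintegral_prod_right' (f := fun q : ℝ × ℝ =>
    ENNReal.ofReal (Real.exp (-q.1 * q.2))) ?_
  fun_prop

theorem wt_nonneg {t : ℝ} (ht : 0 ≤ t) : 0 ≤ wt t := by unfold wt; positivity

theorem wtDensity_nonneg {l : ℝ} (hl : 0 ≤ l) : 0 ≤ wtDensity l := by
  unfold wtDensity
  have := Real.Gamma_pos_of_pos (show (0 : ℝ) < 5 / 4 by norm_num)
  positivity

theorem ofReal_wt_mul_exp {t k : ℝ} (ht : 0 ≤ t) :
    ENNReal.ofReal (wt t * Real.exp (-k * t)) = ∫⁻ l in Ioi (0 : ℝ),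
      ENNReal.ofReal (wtDensity l) * ENNReal.ofReal (Real.exp (-(l + k) * t)) := by
  have hG := Real.Gamma_pos_of_pos (show (0 : ℝ) < 5 / 4 by norm_num)
  have h1 := Real.integral_rpow_mul_exp_neg_mul_Ioi (show (0 : ℝ) < 5 / 4 by norm_num)
    (show 0 < 1 + t by linarith)
  have hpt : ∀ l : ℝ, wtDensity l * Real.exp (-(l + k) * t) =
      (Real.Gamma (5 / 4))⁻¹ * Real.exp (-k * t) *
        (l ^ ((5 / 4 : ℝ) - 1) * Real.exp (-((1 + t) * l))) := by
    intro l
    have : Real.exp (-(l + k) * t) * Real.exp (-l) =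
        Real.exp (-k * t) * Real.exp (-((1 + t) * l)) := by
      rw [← Real.exp_add, ← Real.exp_add]; ring_nf
    unfold wtDensity
    linear_combination (Real.Gamma (5 / 4))⁻¹ * l ^ ((5 / 4 : ℝ) - 1) * this
  have h2 : wt t * Real.exp (-k * t) =
      ∫ l in Ioi (0 : ℝ), wtDensity l * Real.exp (-(l + k) * t) := by
    simp_rw [hpt]
    rw [integral_const_mul, h1, wt, one_div, Real.inv_rpow (by linarith), ← Real.rpow_neg
      (by linarith)]
    field_simp
  have hi : IntegrableOn (fun l => wtDensity l * Real.exp (-(l + k) * t)) (Ioi 0) := by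
    by_contra hcon
    rw [integral_undef hcon] at h2
    have : 0 < wt t := by unfold wt; positivity
    have := mul_pos this (Real.exp_pos (-k * t))
    linarith
  rw [h2, ofReal_integral_eq_lintegral_ofReal hi]
  · refine setLIntegral_congr_fun measurableSet_Ioi (fun l hl => ?_)
    exact ENNReal.ofReal_mul (wtDensity_nonneg (le_of_lt hl))
  · filter_upwards [ae_restrict_mem measurableSet_Ioi] with l hl
    exact mul_nonneg (wtDensity_nonneg (le_of_lt hl)) (Real.exp_nonneg _)

theorem lintegral_wt_mul_exp (μ : Measure ℝ) [SFinite μ] (hμ : ∀ᵐ t ∂μ, 0 ≤ t) (k : ℝ) :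
    ∫⁻ t, ENNReal.ofReal (wt t * Real.exp (-k * t)) ∂μ =
      ∫⁻ l in Ioi (0 : ℝ), ENNReal.ofReal (wtDensity l) * lap μ (l + k) := by
  have h1 : ∫⁻ t, ENNReal.ofReal (wt t * Real.exp (-k * t)) ∂μ = ∫⁻ t, (∫⁻ l in Ioi (0 : ℝ),
      ENNReal.ofReal (wtDensity l) * ENNReal.ofReal (Real.exp (-(l + k) * t))) ∂μ := by
    refine lintegral_congr_ae ?_
    filter_upwards [hμ] with t ht using ofReal_wt_mul_exp ht
  have hmeas := measurable_wtDensity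
  rw [h1, lintegral_lintegral_swap]
  · refine lintegral_congr (fun l => ?_)
    rw [lintegral_const_mul _ (by fun_prop), lap]
  · refine Measurable.aemeasurable ?_
    simp only [Function.uncurry_def]
    fun_prop

theorem lintegral_wtDensity_bound_lt_top (C : ℝ) :
    ∫⁻ l in Ioi (0 : ℝ), ENNReal.ofReal (wtDensity l) * ENNReal.ofReal (C * (1 + 1 / l)) < ∞ := by
  have i1 := Real.GammaIntegral_convergent (show (0 : ℝ) < 5 / 4 by norm_num)
  have i2 := Real.GammaIntegral_convergent (show (0 : ℝ) < 1 / 4 by norm_num)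
  have i3 := (i1.add i2).const_mul (C * (Real.Gamma (5 / 4))⁻¹)
  have h : ∫⁻ l in Ioi (0 : ℝ),
      ENNReal.ofReal (wtDensity l) * ENNReal.ofReal (C * (1 + 1 / l)) =
      ∫⁻ l in Ioi (0 : ℝ), ENNReal.ofReal (C * (Real.Gamma (5 / 4))⁻¹ *
        (Real.exp (-l) * l ^ ((5 / 4 : ℝ) - 1) + Real.exp (-l) * l ^ ((1 / 4 : ℝ) - 1))) := by
    refine setLIntegral_congr_fun measurableSet_Ioi (fun l hl => ?_)
    have hl' : (0 : ℝ) < l := hl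
    rw [← ENNReal.ofReal_mul (wtDensity_nonneg hl'.le)]
    congr 1
    have : l ^ ((5 / 4 : ℝ) - 1) = l * l ^ ((1 / 4 : ℝ) - 1) := by
      rw [mul_comm, ← Real.rpow_add_one hl'.ne']; norm_num
    rw [wtDensity, this]
    field_simp
  rw [h]
  exact i3.lintegral_lt_top

/-- A measure whose Laplace transform is `O(1 + 1 / l)` integrates the weight. -/
theorem lintegral_wt_mul_exp_lt_top {μ : Measure ℝ} [SFinite μ] (hμ : ∀ᵐ t ∂μ, 0 ≤ t) {C : ℝ}
    (hC : 0 ≤ C) (hb : ∀ l, 0 < l → lap μ l ≤ ENNReal.ofReal (C * (1 + 1 / l))) {k : ℝ}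
    (hk : 0 ≤ k) : ∫⁻ t, ENNReal.ofReal (wt t * Real.exp (-k * t)) ∂μ < ∞ := by
  rw [lintegral_wt_mul_exp μ hμ]
  refine lt_of_le_of_lt ?_ (lintegral_wtDensity_bound_lt_top C)
  refine setLIntegral_mono' measurableSet_Ioi (fun l hl => ?_)
  have hl' : (0 : ℝ) < l := hl
  gcongr
  refine (hb _ (by positivity)).trans (ENNReal.ofReal_le_ofReal ?_)
  gcongr
  linarith

theorem tendsto_lintegral_wt_mul_exp {ι : Type*} {l : Filter ι} [l.IsCountablyGenerated]
    {μ : ι → Measure ℝ} {ν : Measure ℝ} [∀ i, SFinite (μ i)] [SFinite ν]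
    (hμ : ∀ i, ∀ᵐ t ∂(μ i), 0 ≤ t) (hν : ∀ᵐ t ∂ν, 0 ≤ t) {C : ℝ} (hC : 0 ≤ C)
    (hb : ∀ᶠ i in l, ∀ s, 0 < s → lap (μ i) s ≤ ENNReal.ofReal (C * (1 + 1 / s)))
    (hlim : ∀ s, 0 < s → Tendsto (fun i => lap (μ i) s) l (𝓝 (lap ν s))) {k : ℝ} (hk : 0 ≤ k) :
    Tendsto (fun i => ∫⁻ t, ENNReal.ofReal (wt t * Real.exp (-k * t)) ∂(μ i)) l
      (𝓝 (∫⁻ t, ENNReal.ofReal (wt t * Real.exp (-k * t)) ∂ν)) := by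
  simp_rw [lintegral_wt_mul_exp _ hν, fun i => lintegral_wt_mul_exp (μ i) (hμ i) k]
  refine tendsto_lintegral_filter_of_dominated_convergence
    (fun s => ENNReal.ofReal (wtDensity s) * ENNReal.ofReal (C * (1 + 1 / s))) ?_ ?_
    (lintegral_wtDensity_bound_lt_top C).ne ?_
  · refine Eventually.of_forall (fun i => ?_)
    have h1 := measurable_wtDensity
    have h2 := measurable_lap (μ i)
    fun_prop
  · filter_upwards [hb] with i hi
    filter_upwards [ae_restrict_mem measurableSet_Ioi] with s hs
    have hs' : (0 : ℝ) < s := hs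
    gcongr
    refine (hi _ (by positivity)).trans (ENNReal.ofReal_le_ofReal ?_)
    gcongr
    linarith
  · filter_upwards [ae_restrict_mem measurableSet_Ioi] with s hs
    have hs' : (0 : ℝ) < s := hs
    exact ENNReal.Tendsto.const_mul (hlim _ (by positivity)) (Or.inr ENNReal.ofReal_ne_top)

/-- A Tauberian theorem in Karamata's style: if the Laplace transforms of `μ i` are `O(1 + 1 / s)`
uniformly and converge pointwise, then the integrals of `wt t * H (exp (-t))` converge for every
continuous `H`. -/
theorem tendsto_integral_of_tendsto_lap {ι : Type*} {l : Filter ι} [l.IsCountablyGenerated]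
    {μ : ι → Measure ℝ} {ν : Measure ℝ} [∀ i, SFinite (μ i)] [SFinite ν]
    (hμ : ∀ i, ∀ᵐ t ∂(μ i), 0 ≤ t) (hν : ∀ᵐ t ∂ν, 0 ≤ t) {C : ℝ} (hC : 0 ≤ C)
    (hb : ∀ᶠ i in l, ∀ s, 0 < s → lap (μ i) s ≤ ENNReal.ofReal (C * (1 + 1 / s)))
    (hbν : ∀ s, 0 < s → lap ν s ≤ ENNReal.ofReal (C * (1 + 1 / s)))
    (hlim : ∀ s, 0 < s → Tendsto (fun i => lap (μ i) s) l (𝓝 (lap ν s)))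
    {H : ℝ → ℝ} (hH : ContinuousOn H (Icc 0 1)) (hHm : Measurable H) :
    Tendsto (fun i => ∫ t, wt t * H (Real.exp (-t)) ∂(μ i)) l
      (𝓝 (∫ t, wt t * H (Real.exp (-t)) ∂ν)) := by
  -- The weighted measures are finite; transport them to `[0, 1]` by `t ↦ exp (-t)`.
  let T : Measure ℝ → Measure ℝ := fun κ =>
    (κ.withDensity (fun t => ENNReal.ofReal (wt t))).map (fun t => Real.exp (-t))
  have hwm := measurable_wt
  have hem : Measurable (fun t : ℝ => Real.exp (-t)) := by fun_prop
  have hT : ∀ κ : Measure ℝ, (∀ᵐ t ∂κ, 0 ≤ t) → ∀ F : ℝ → ℝ, Measurable F →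
      ∫ x, F x ∂(T κ) = ∫ t, wt t * F (Real.exp (-t)) ∂κ := by
    intro κ hκ F hF
    rw [integral_map hem.aemeasurable hF.aestronglyMeasurable,
      integral_withDensity_eq_integral_toReal_smul (by fun_prop) (by simp)]
    refine integral_congr_ae ?_
    filter_upwards [hκ] with t ht
    rw [ENNReal.toReal_ofReal (wt_nonneg ht), smul_eq_mul]
  have hTsupp : ∀ κ : Measure ℝ, (∀ᵐ t ∂κ, 0 ≤ t) → ∀ᵐ x ∂(T κ), x ∈ Icc (0 : ℝ) 1 := by
    intro κ hκ
    refine (ae_map_iff hem.aemeasurable measurableSet_Icc).2 ?_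
    filter_upwards [(withDensity_absolutelyContinuous κ _).ae_le hκ] with t ht
    exact ⟨Real.exp_nonneg _, by simpa using ht⟩
  have hTfin : ∀ κ : Measure ℝ, [SFinite κ] → (∀ᵐ t ∂κ, 0 ≤ t) →
      (∀ s, 0 < s → lap κ s ≤ ENNReal.ofReal (C * (1 + 1 / s))) → IsFiniteMeasure (T κ) := by
    intro κ _ hκ hκb
    have h := lintegral_wt_mul_exp_lt_top hκ hC hκb le_rfl
    simp only [neg_zero, zero_mul, Real.exp_zero, mul_one] at h
    have := isFiniteMeasure_withDensity h.ne
    exact Measure.isFiniteMeasure_map _ _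
  have hTmom : ∀ κ : Measure ℝ, (∀ᵐ t ∂κ, 0 ≤ t) → ∀ k : ℕ, ∫ x, x ^ k ∂(T κ) =
      (∫⁻ t, ENNReal.ofReal (wt t * Real.exp (-(k : ℝ) * t)) ∂κ).toReal := by
    intro κ hκ k
    have hexp : ∀ t : ℝ, Real.exp (-t) ^ k = Real.exp (-(k : ℝ) * t) := by
      intro t
      rw [← Real.exp_nat_mul]; ring_nf
    rw [hT κ hκ _ (by fun_prop)]
    simp_rw [hexp]
    refine integral_eq_lintegral_of_nonneg_ae ?_ (by fun_prop)
    filter_upwards [hκ] with t ht using mul_nonneg (wt_nonneg ht) (Real.exp_nonneg _)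
  have := hTfin ν hν hbν
  rw [← hT ν hν H hHm]
  simp_rw [← fun i => hT (μ i) (hμ i) H hHm]
  refine tendsto_integral_of_tendsto_moments ?_ (fun i => hTsupp _ (hμ i)) (hTsupp ν hν) ?_ hH
  · filter_upwards [hb] with i hi using hTfin _ (hμ i) hi
  · intro k
    simp_rw [hTmom ν hν, fun i => hTmom (μ i) (hμ i)]
    exact (ENNReal.tendsto_toReal (lintegral_wt_mul_exp_lt_top hν hC hbν k.cast_nonneg).ne).comp
      (tendsto_lintegral_wt_mul_exp hμ hν hC hb hlim k.cast_nonneg)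

/-! ### The heat kernel as a function of time -/

/-- The function `t ↦ t^{-b} e^{-1/(4t)}`: for `b = d / 2` it is, up to a constant, the heat kernel
at distance `1` as a function of time. -/
def timeKernel (b t : ℝ) : ℝ := t ^ (-b) * Real.exp (-1 / (4 * t))

/-- The quotient of `timeKernel b` by the weight `wt`. Its value at `0` is `0` if `b ≠ 0`. -/
def timeRatio (b t : ℝ) : ℝ := timeKernel b t * (1 + t) ^ (5 / 4 : ℝ)

theorem measurable_timeKernel (b : ℝ) : Measurable (timeKernel b) := by
  unfold timeKernel; fun_prop

theorem measurable_timeRatio (b : ℝ) : Measurable (timeRatio b) := by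
  unfold timeRatio
  have := measurable_timeKernel b
  fun_prop

theorem timeKernel_nonneg (b : ℝ) {t : ℝ} (ht : 0 ≤ t) : 0 ≤ timeKernel b t := by
  unfold timeKernel; positivity

theorem timeKernel_zero {b : ℝ} (hb : 0 < b) : timeKernel b 0 = 0 := by
  simp [timeKernel, Real.zero_rpow (neg_ne_zero.2 hb.ne')]

theorem timeRatio_zero {b : ℝ} (hb : 0 < b) : timeRatio b 0 = 0 := by
  simp [timeRatio, timeKernel_zero hb]

theorem wt_mul_timeRatio (b : ℝ) {t : ℝ} (ht : 0 ≤ t) :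
    wt t * timeRatio b t = timeKernel b t := by
  have : wt t * (1 + t) ^ (5 / 4 : ℝ) = 1 := by
    rw [wt, ← Real.rpow_add (by linarith)]; simp
  rw [timeRatio]
  linear_combination timeKernel b t * this

theorem tendsto_timeKernel_zero (b : ℝ) : Tendsto (timeKernel b) (𝓝[>] 0) (𝓝 0) := by
  have h := (tendsto_rpow_mul_exp_neg_mul_atTop_nhds_zero b (1 / 4) (by norm_num)).comp
    tendsto_inv_nhdsGT_zero
  refine h.congr' ?_
  filter_upwards [self_mem_nhdsWithin] with t ht
  have ht' : (0 : ℝ) < t := ht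
  simp only [Function.comp_apply, timeKernel]
  rw [Real.inv_rpow ht'.le, Real.rpow_neg ht'.le]
  congr 2
  field_simp

theorem continuousOn_timeRatio {b : ℝ} (hb : 0 < b) : ContinuousOn (timeRatio b) (Ici 0) := by
  intro t ht
  rcases eq_or_lt_of_le (show (0 : ℝ) ≤ t from ht) with h0 | h0
  · subst h0
    rw [← Ioi_insert, continuousWithinAt_insert_self]
    have h1 : Tendsto (fun t : ℝ => (1 + t) ^ (5 / 4 : ℝ)) (𝓝[>] 0) (𝓝 ((1 + 0) ^ (5 / 4 : ℝ))) :=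
      ((ContinuousAt.rpow_const (by fun_prop) (Or.inl (by norm_num))).tendsto).mono_left
        nhdsWithin_le_nhds
    have h2 := (tendsto_timeKernel_zero b).mul h1
    rw [ContinuousWithinAt, timeRatio_zero hb]
    rw [zero_mul] at h2
    exact h2
  · refine ContinuousAt.continuousWithinAt ?_
    unfold timeRatio timeKernel
    refine ContinuousAt.mul (ContinuousAt.mul ?_ ?_) ?_
    · exact ContinuousAt.rpow_const continuousAt_id (Or.inl h0.ne')
    · have : (4 * t) ≠ 0 := by positivity
      fun_prop (disch := assumption)
    · exact ContinuousAt.rpow_const (by fun_prop) (Or.inl (by positivity))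

theorem tendsto_timeRatio_atTop {b : ℝ} (hb : 5 / 4 < b) :
    Tendsto (timeRatio b) atTop (𝓝 0) := by
  have h : Tendsto (fun t : ℝ => (2 : ℝ) ^ (5 / 4 : ℝ) * t ^ (-(b - 5 / 4))) atTop (𝓝 0) := by
    simpa using (tendsto_rpow_neg_atTop (show 0 < b - 5 / 4 by linarith)).const_mul
      ((2 : ℝ) ^ (5 / 4 : ℝ))
  refine squeeze_zero' ?_ ?_ h
  · filter_upwards [eventually_ge_atTop 0] with t ht
    exact mul_nonneg (timeKernel_nonneg b ht) (by positivity)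
  · filter_upwards [eventually_ge_atTop 1] with t ht
    have ht0 : 0 < t := by linarith
    have h1 : Real.exp (-1 / (4 * t)) ≤ 1 :=
      Real.exp_le_one_iff.2 (div_nonpos_of_nonpos_of_nonneg (by norm_num) (by positivity))
    have h2 : (1 + t) ^ (5 / 4 : ℝ) ≤ (2 * t) ^ (5 / 4 : ℝ) := by
      gcongr; linarith
    calc timeRatio b t ≤ t ^ (-b) * 1 * (2 * t) ^ (5 / 4 : ℝ) := by
          unfold timeRatio timeKernel; gcongr
      _ = 2 ^ (5 / 4 : ℝ) * t ^ (-(b - 5 / 4)) := by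
          rw [Real.mul_rpow (by norm_num) ht0.le, neg_sub, sub_eq_add_neg, Real.rpow_add ht0]
          ring

/-- The ratio is continuous on `[0, ∞]`, in the coordinate `x = e^{-t}`; the junk value
`log 0 = 0` gives the correct value `0` at `t = ∞`. -/
theorem continuousOn_timeRatio_neg_log {b : ℝ} (hb : 5 / 4 < b) :
    ContinuousOn (fun x => timeRatio b (-Real.log x)) (Icc 0 1) := by
  intro x hx
  rcases eq_or_lt_of_le hx.1 with h0 | h0
  · subst h0
    have h1 : Tendsto (fun x => timeRatio b (-Real.log x)) (𝓝[>] 0) (𝓝 0) :=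
      (tendsto_timeRatio_atTop hb).comp (tendsto_neg_atBot_atTop.comp Real.tendsto_log_nhdsGT_zero)
    have h2 : ContinuousWithinAt (fun x => timeRatio b (-Real.log x)) (Ici 0) 0 := by
      rw [← Ioi_insert, continuousWithinAt_insert_self, ContinuousWithinAt, Real.log_zero, neg_zero,
        timeRatio_zero (by linarith)]
      exact h1
    exact h2.mono Icc_subset_Ici_self
  · have h1 : ContinuousWithinAt (fun x => -Real.log x) (Icc 0 1) x :=
      (Real.continuousAt_log h0.ne').neg.continuousWithinAt
    refine ContinuousWithinAt.comp (t := Ici 0)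
      (continuousOn_timeRatio (show 0 < b by linarith) _ ?_) h1 ?_
    · simpa using Real.log_nonpos hx.1 hx.2
    · intro y hy
      simpa using Real.log_nonpos hy.1 hy.2

theorem integral_timeKernel {b : ℝ} (hb : 1 < b) :
    ∫ t in Ioi (0 : ℝ), timeKernel b t = 4 ^ (b - 1) * Real.Gamma (b - 1) := by
  -- substitute `t ↦ 1 / t` in the Gamma integral
  have h1 := Real.integral_rpow_mul_exp_neg_mul_Ioi (show 0 < b - 1 by linarith)
    (show (0 : ℝ) < 1 / 4 by norm_num)
  have h2 := integral_comp_rpow_Ioi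
    (fun t : ℝ => t ^ (b - 1 - 1) * Real.exp (-(1 / 4 * t))) (show (-1 : ℝ) ≠ 0 by norm_num)
  rw [h1] at h2
  rw [show (1 / (1 / 4) : ℝ) = 4 by norm_num] at h2
  rw [← h2]
  refine setIntegral_congr_fun measurableSet_Ioi (fun t ht => ?_)
  have ht' : (0 : ℝ) < t := ht
  simp only [timeKernel, smul_eq_mul, abs_neg, abs_one, one_mul]
  rw [← mul_assoc, ← Real.rpow_mul ht'.le, ← Real.rpow_add ht', Real.rpow_neg_one]
  congr 2
  · ring
  · field_simp

/-! ### The Laplace exponent -/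

theorem log_one_add_le {s : ℝ} (hs : 0 ≤ s) :
    Real.log (1 + s) ≤ s - s ^ 2 / (2 * (1 + s)) := by
  have hmono : MonotoneOn (fun x : ℝ => x - x ^ 2 / (2 * (1 + x)) - Real.log (1 + x)) (Ici 0) := by
    have hder : ∀ x : ℝ, 0 ≤ x → HasDerivAt
        (fun x : ℝ => x - x ^ 2 / (2 * (1 + x)) - Real.log (1 + x))
        (x ^ 2 / (2 * (1 + x) ^ 2)) x := by
      intro x hx
      have h1 : (1 + x) ≠ 0 := by positivity
      have e1 : HasDerivAt (fun x : ℝ => 1 + x) 1 x := (hasDerivAt_id x).const_add 1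
      have e2 := (hasDerivAt_id x).sub ((hasDerivAt_pow 2 x).div (e1.const_mul 2)
        (by positivity)) |>.sub (e1.log h1)
      refine e2.congr_deriv ?_
      field_simp
      ring
    refine monotoneOn_of_deriv_nonneg (convex_Ici 0) ?_ ?_ ?_
    · exact fun x hx => (hder x hx).continuousAt.continuousWithinAt
    · intro x hx
      rw [interior_Ici] at hx
      exact (hder x (le_of_lt hx)).differentiableAt.differentiableWithinAt
    · intro x hx
      rw [interior_Ici] at hx
      rw [(hder x (le_of_lt hx)).deriv]
      positivity
  have := hmono (show (0 : ℝ) ∈ Ici 0 by simp) hs hs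
  simp only [ne_eq, OfNat.ofNat_ne_zero, not_false_eq_true, zero_pow, zero_div, sub_zero, add_zero,
    Real.log_one] at this
  linarith

theorem log_one_add_pos {s : ℝ} (hs : 0 < s) : 0 < Real.log (1 + s) :=
  Real.log_pos (by linarith)

theorem sub_log_lower {s : ℝ} (hs : 0 ≤ s) : s ^ 2 / (2 * (1 + s)) ≤ s - Real.log (1 + s) := by
  linarith [log_one_add_le hs]

theorem sub_log_pos {s : ℝ} (hs : 0 < s) : 0 < s - Real.log (1 + s) :=
  lt_of_lt_of_le (by positivity) (sub_log_lower hs.le)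

theorem one_div_phi {s : ℝ} (hs : 0 < s) :
    1 / phi s = Real.log (1 + s) / (s - Real.log (1 + s)) := by
  have h1 := log_one_add_pos hs
  have h2 := sub_log_pos hs
  have : phi s = (s - Real.log (1 + s)) / Real.log (1 + s) := by
    rw [phi]; field_simp
  rw [this, one_div_div]

theorem phi_pos {s : ℝ} (hs : 0 < s) : 0 < phi s := by
  rw [← one_div_pos, one_div_phi hs]
  exact div_pos (log_one_add_pos hs) (sub_log_pos hs)

theorem two_le_mul_one_div_phi {s : ℝ} (hs : 0 < s) : 2 ≤ s * (1 / phi s) := by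
  have h1 := Real.le_log_one_add_of_nonneg hs.le
  have h2 := sub_log_pos hs
  rw [one_div_phi hs, ← mul_div_assoc, le_div_iff₀ h2]
  rw [div_le_iff₀ (by positivity)] at h1
  nlinarith

theorem mul_one_div_phi_le_log {s : ℝ} (hs : 0 < s) :
    s * (1 / phi s) ≤ 2 * (1 + Real.log (1 + s)) := by
  have h0 := log_one_add_pos hs
  have h1 := sub_log_lower hs.le
  have h2 := sub_log_pos hs
  have h3 : Real.log (1 + s) ≤ s := by
    have := Real.log_le_sub_one_of_pos (show 0 < 1 + s by linarith)
    linarith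
  rw [one_div_phi hs, ← mul_div_assoc, div_le_iff₀ h2]
  rw [div_le_iff₀ (by positivity)] at h1
  set L := Real.log (1 + s)
  -- `s L ≤ 2 (1 + s) (s - L) L / s` by the lower bound, and `(1 + s) L ≤ s (1 + L)`.
  have h4 : s * (s * L) ≤ s * (2 * (1 + L) * (s - L)) := by
    have a1 : s ^ 2 * L ≤ (s - L) * (2 * (1 + s)) * L := by gcongr
    have a2 : (1 + s) * L ≤ s * (1 + L) := by nlinarith
    have a3 : (s - L) * ((1 + s) * L) ≤ (s - L) * (s * (1 + L)) := by gcongr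
    nlinarith
  exact le_of_mul_le_mul_left h4 hs

theorem mul_one_div_phi_le {s : ℝ} (hs : 0 < s) : s * (1 / phi s) ≤ 2 * (1 + s) := by
  have h3 := Real.log_le_sub_one_of_pos (show 0 < 1 + s by linarith)
  have := mul_one_div_phi_le_log hs
  linarith

theorem tendsto_mul_one_div_phi_zero :
    Tendsto (fun s => s * (1 / phi s)) (𝓝[>] 0) (𝓝 2) := by
  have h : Tendsto (fun s : ℝ => 2 * (1 + s)) (𝓝[>] 0) (𝓝 2) := by
    have : Tendsto (fun s : ℝ => 2 * (1 + s)) (𝓝 0) (𝓝 (2 * (1 + 0))) :=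
      Continuous.tendsto (by fun_prop) 0
    simpa using this.mono_left nhdsWithin_le_nhds
  refine tendsto_of_tendsto_of_tendsto_of_le_of_le' tendsto_const_nhds h ?_ ?_
  · filter_upwards [self_mem_nhdsWithin] with s hs using two_le_mul_one_div_phi hs
  · filter_upwards [self_mem_nhdsWithin] with s hs using mul_one_div_phi_le hs

theorem tendsto_log_mul_div_log {c : ℝ} (hc : 0 < c) :
    Tendsto (fun v => Real.log (1 + c * v) / Real.log v) atTop (𝓝 1) := by
  have h1 : Tendsto (fun v : ℝ => Real.log (v⁻¹ + c) / Real.log v + 1) atTop (𝓝 (0 + 1)) := by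
    refine Tendsto.add ?_ tendsto_const_nhds
    refine Tendsto.div_atTop (a := Real.log (0 + c)) ?_ Real.tendsto_log_atTop
    have : Tendsto (fun v : ℝ => v⁻¹ + c) atTop (𝓝 (0 + c)) :=
      tendsto_inv_atTop_zero.add_const c
    exact (Real.continuousAt_log (by simpa using hc.ne')).tendsto.comp this
  rw [zero_add] at h1
  refine h1.congr' ?_
  filter_upwards [eventually_gt_atTop 1] with v hv
  have hv0 : 0 < v := by linarith
  have hl : 0 < Real.log v := Real.log_pos hv
  have : 1 + c * v = (v⁻¹ + c) * v := by field_simp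
  rw [this, Real.log_mul (by positivity) hv0.ne', add_div, div_self hl.ne']

theorem tendsto_one_div_phi_div_log :
    Tendsto (fun s => s * (1 / phi s) / Real.log (1 + s)) atTop (𝓝 1) := by
  have h1 : Tendsto (fun s : ℝ => Real.log (1 + s) / s) atTop (𝓝 0) := by
    have a := tendsto_log_mul_div_log one_pos
    have b := Real.tendsto_pow_log_div_mul_add_atTop 1 0 1 one_ne_zero
    have c := a.mul b
    rw [one_mul] at c
    refine (c.congr' ?_)
    filter_upwards [eventually_gt_atTop 1] with v hv
    have hl : 0 < Real.log v := Real.log_pos hv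
    simp only [one_mul, pow_one, add_zero]
    field_simp
  have h2 : Tendsto (fun s : ℝ => (1 - Real.log (1 + s) / s)⁻¹) atTop (𝓝 1) := by
    have := (h1.const_sub 1).inv₀ (by norm_num)
    simpa using this
  refine h2.congr' ?_
  filter_upwards [eventually_gt_atTop 0] with s hs
  have := log_one_add_pos hs
  have := sub_log_pos hs
  have h3 : 1 - Real.log (1 + s) / s = (s - Real.log (1 + s)) / s := by field_simp
  rw [one_div_phi hs, h3, inv_div]
  field_simp

/-! ### Asymptotics of the Green function -/

/-- The image of `U` under `t ↦ t / r ^ 2`, multiplied by `c`. -/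
def rescale (U : Measure ℝ) (c r : ℝ) : Measure ℝ :=
  ENNReal.ofReal c • U.map (fun t => t / r ^ 2)

instance (U : Measure ℝ) [SFinite U] (c r : ℝ) : SFinite (rescale U c r) := by
  unfold rescale; infer_instance

theorem ae_nonneg_rescale {U : Measure ℝ} (hU : ∀ᵐ t ∂U, 0 ≤ t) (c r : ℝ) :
    ∀ᵐ t ∂(rescale U c r), 0 ≤ t := by
  refine Measure.ae_smul_measure ?_ _
  refine (ae_map_iff (by fun_prop) measurableSet_Ici).2 ?_
  filter_upwards [hU] with t ht
  exact div_nonneg ht (sq_nonneg r)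

theorem lap_rescale (U : Measure ℝ) (c r s : ℝ) :
    lap (rescale U c r) s = ENNReal.ofReal c * lap U (s / r ^ 2) := by
  rw [lap, rescale, lintegral_smul_measure, lintegral_map (by fun_prop) (by fun_prop), lap,
    smul_eq_mul]
  congr 2
  funext t
  congr 2
  ring

theorem integral_rescale (U : Measure ℝ) {c : ℝ} (hc : 0 ≤ c) (r : ℝ) {f : ℝ → ℝ}
    (hf : Measurable f) : ∫ t, f t ∂(rescale U c r) = c * ∫ t, f (t / r ^ 2) ∂U := by
  rw [rescale, integral_smul_measure, integral_map (by fun_prop) hf.aestronglyMeasurable,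
    ENNReal.toReal_ofReal hc, smul_eq_mul]

theorem lap_volume {s : ℝ} (hs : 0 < s) :
    lap (volume.restrict (Ioi 0)) s = ENNReal.ofReal (1 / s) := by
  have h : ∫ x in Ioi (0 : ℝ), Real.exp (-s * x) = 1 / s := by
    rw [integral_exp_mul_Ioi (neg_lt_zero.2 hs)]
    simp
  have hi : IntegrableOn (fun x : ℝ => Real.exp (-s * x)) (Ioi 0) := exp_neg_integrableOn_Ioi 0 hs
  rw [lap, ← ofReal_integral_eq_lintegral_ofReal hi
    (Eventually.of_forall fun _ => Real.exp_nonneg _), h]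

theorem rpow_mul_exp_eq_timeKernel (d : ℕ) {r t : ℝ} (hr : 0 < r) (ht : 0 ≤ t) :
    t ^ (-(d : ℝ) / 2) * Real.exp (-r ^ 2 / (4 * t)) =
      r ^ (-(d : ℝ)) * timeKernel ((d : ℝ) / 2) (t / r ^ 2) := by
  have h1 : (t / r ^ 2) ^ (-((d : ℝ) / 2)) = t ^ (-(d : ℝ) / 2) * r ^ (d : ℝ) := by
    rw [Real.div_rpow ht (by positivity), ← Real.rpow_natCast r 2, ← Real.rpow_mul hr.le, neg_div,
      div_eq_mul_inv, ← Real.rpow_neg hr.le]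
    congr 2
    push_cast
    ring
  have h2 : -1 / (4 * (t / r ^ 2)) = -r ^ 2 / (4 * t) := by
    field_simp
  have h3 : r ^ (-(d : ℝ)) * r ^ (d : ℝ) = 1 := by
    rw [← Real.rpow_add hr]; simp
  rw [timeKernel, h1, h2]
  linear_combination -(t ^ (-(d : ℝ) / 2) * Real.exp (-r ^ 2 / (4 * t))) * h3

theorem greenRadial_eq_lintegral {d : ℕ} {U : Measure ℝ} (hd : 0 < d) (hU : ∀ᵐ t ∂U, 0 ≤ t)
    (r : ℝ) : greenRadial d U r = ENNReal.ofReal ((4 * Real.pi) ^ (-(d : ℝ) / 2)) *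
      ∫⁻ t, ENNReal.ofReal (t ^ (-(d : ℝ) / 2) * Real.exp (-r ^ 2 / (4 * t))) ∂U := by
  have hd' : (0 : ℝ) < d := by exact_mod_cast hd
  rw [greenRadial, ← lintegral_indicator measurableSet_Ioi]
  congr 1
  refine lintegral_congr_ae ?_
  filter_upwards [hU] with t ht
  rcases ht.eq_or_lt with h | h
  · subst h
    have : -(d : ℝ) / 2 ≠ 0 := by
      have := div_pos hd' two_pos
      rw [neg_div]
      exact neg_ne_zero.2 this.ne'
    simp [Real.zero_rpow this]
  · simp [h]

theorem greenRadial_eq {d : ℕ} {U : Measure ℝ} (hd : 0 < d) (hU : ∀ᵐ t ∂U, 0 ≤ t) {r : ℝ}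
    (hr : 0 < r) : greenRadial d U r = ENNReal.ofReal ((4 * Real.pi) ^ (-(d : ℝ) / 2)) *
      ∫⁻ t, ENNReal.ofReal (r ^ (-(d : ℝ)) * timeKernel ((d : ℝ) / 2) (t / r ^ 2)) ∂U := by
  rw [greenRadial_eq_lintegral hd hU]
  congr 1
  refine lintegral_congr_ae ?_
  filter_upwards [hU] with t ht
  rw [rpow_mul_exp_eq_timeKernel d hr ht]

theorem toReal_greenRadial {d : ℕ} {U : Measure ℝ} (hd : 0 < d) (hU : ∀ᵐ t ∂U, 0 ≤ t) {r : ℝ}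
    (hr : 0 < r) : (greenRadial d U r).toReal = (4 * Real.pi) ^ (-(d : ℝ) / 2) *
      (r ^ (-(d : ℝ)) * ∫ t, timeKernel ((d : ℝ) / 2) (t / r ^ 2) ∂U) := by
  have hm : Measurable (fun t => timeKernel ((d : ℝ) / 2) (t / r ^ 2)) :=
    (measurable_timeKernel _).comp (by fun_prop)
  rw [greenRadial_eq hd hU hr, ENNReal.toReal_mul, ENNReal.toReal_ofReal (by positivity),
    ← integral_const_mul, integral_eq_lintegral_of_nonneg_ae _
      (hm.const_mul _).aestronglyMeasurable]
  filter_upwards [hU] with t ht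
  have := timeKernel_nonneg ((d : ℝ) / 2) (t := t / r ^ 2) (by positivity)
  simp only [Pi.zero_apply]
  positivity

theorem exists_timeRatio_le {b : ℝ} (hb : 5 / 4 < b) :
    ∃ K, 0 ≤ K ∧ ∀ t, 0 ≤ t → timeRatio b t ≤ K := by
  obtain ⟨K, hK⟩ := isCompact_Icc.exists_bound_of_continuousOn (continuousOn_timeRatio_neg_log hb)
  refine ⟨K, (norm_nonneg _).trans (hK 0 (by simp)), fun t ht => ?_⟩
  have := hK (Real.exp (-t)) ⟨Real.exp_nonneg _, by simpa using ht⟩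
  simp only [Real.log_exp, neg_neg] at this
  exact (le_abs_self _).trans this

theorem greenRadial_lt_top {d : ℕ} (hd : 3 ≤ d) {U : Measure ℝ} [SFinite U]
    (hU : ∀ᵐ t ∂U, 0 ≤ t) (hlap : ∀ s, 0 < s → lap U s = ENNReal.ofReal (1 / phi s)) {r : ℝ}
    (hr : 0 < r) : greenRadial d U r < ∞ := by
  have hd' : (3 : ℝ) ≤ d := by exact_mod_cast hd
  obtain ⟨K, hK0, hK⟩ := exists_timeRatio_le (show 5 / 4 < (d : ℝ) / 2 by linarith)
  rw [greenRadial_eq (by omega) hU hr]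
  refine ENNReal.mul_lt_top ENNReal.ofReal_lt_top ?_
  have hw := measurable_wt
  have h1 : ∫⁻ t, ENNReal.ofReal (wt t) ∂(rescale U 1 r) < ∞ := by
    have h := lintegral_wt_mul_exp_lt_top (ae_nonneg_rescale hU 1 r)
      (show 0 ≤ 2 * (1 + r ^ 2) by positivity) ?_ (le_refl 0)
    · simpa using h
    · intro s hs
      have hs' : 0 < s / r ^ 2 := by positivity
      rw [lap_rescale, hlap _ hs', ENNReal.ofReal_one, one_mul]
      refine ENNReal.ofReal_le_ofReal ?_
      have h2 := mul_one_div_phi_le hs'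
      rw [← le_div_iff₀' hs'] at h2
      refine h2.trans ?_
      have : 2 * (1 + s / r ^ 2) / (s / r ^ 2) = 2 * (1 + r ^ 2 * (1 / s)) := by
        field_simp
        ring
      rw [this]
      have : 0 < 1 / s := by positivity
      nlinarith [sq_nonneg r]
  rw [rescale, ENNReal.ofReal_one, one_smul, lintegral_map (by fun_prop) (by fun_prop)] at h1
  refine lt_of_le_of_lt (lintegral_mono_ae (g := fun t => ENNReal.ofReal (r ^ (-(d : ℝ)) * K) *
    ENNReal.ofReal (wt (t / r ^ 2))) ?_) ?_
  · filter_upwards [hU] with t ht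
    have ht' : 0 ≤ t / r ^ 2 := by positivity
    rw [← ENNReal.ofReal_mul (by positivity), ← wt_mul_timeRatio _ ht', mul_assoc]
    refine ENNReal.ofReal_le_ofReal ?_
    have := mul_le_mul_of_nonneg_left (hK _ ht') (wt_nonneg ht')
    exact mul_le_mul_of_nonneg_left (by linarith) (by positivity)
  · rw [lintegral_const_mul _ (by fun_prop)]
    exact ENNReal.mul_lt_top ENNReal.ofReal_lt_top h1

/-- If `U`, rescaled by `t ↦ t / r ^ 2` and divided by `r ^ 2 * q r`, converges to Lebesgue measure
along a filter in the sense of Laplace transforms, with a uniform bound `C * (1 + 1 / s)`, then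
`greenRadial d U r` behaves like `q r` times the Newtonian kernel of Brownian motion. -/
theorem isEquivalent_greenRadial {d : ℕ} (hd : 3 ≤ d) {U : Measure ℝ} [SFinite U]
    (hU : ∀ᵐ t ∂U, 0 ≤ t) (hlap : ∀ s, 0 < s → lap U s = ENNReal.ofReal (1 / phi s))
    {l : Filter ℝ} [l.IsCountablyGenerated] {q : ℝ → ℝ} (hq : ∀ᶠ r in l, 0 < r ∧ 0 < q r)
    {C : ℝ} (hC : 1 ≤ C) (hb : ∀ᶠ r in l, ∀ s, 0 < s →
      1 / (r ^ 2 * q r) * (1 / phi (s / r ^ 2)) ≤ C * (1 + 1 / s))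
    (hlim : ∀ s, 0 < s →
      Tendsto (fun r => 1 / (r ^ 2 * q r) * (1 / phi (s / r ^ 2))) l (𝓝 (1 / s))) :
    Asymptotics.IsEquivalent l (fun r => (greenRadial d U r).toReal)
      (fun r => Real.Gamma ((d : ℝ) / 2 - 1) / (4 * Real.pi ^ ((d : ℝ) / 2)) *
        r ^ (2 - (d : ℝ)) * q r) := by
  have hd' : (3 : ℝ) ≤ d := by exact_mod_cast hd
  have hb1 : 5 / 4 < (d : ℝ) / 2 := by linarith
  set b := (d : ℝ) / 2 with hbd
  let μ : ℝ → Measure ℝ := fun r => rescale U (1 / (r ^ 2 * q r)) r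
  have hlapμ : ∀ r, 0 < r → 0 < q r → ∀ s, 0 < s →
      lap (μ r) s = ENNReal.ofReal (1 / (r ^ 2 * q r) * (1 / phi (s / r ^ 2))) := by
    intro r hr hqr s hs
    rw [lap_rescale, hlap _ (by positivity), ENNReal.ofReal_mul (by positivity)]
  have hν : ∀ᵐ t ∂(volume.restrict (Ioi (0 : ℝ))), 0 ≤ t := by
    filter_upwards [ae_restrict_mem measurableSet_Ioi] with t ht using le_of_lt ht
  have key := tendsto_integral_of_tendsto_lap (l := l) (μ := μ) (ν := volume.restrict (Ioi (0 : ℝ)))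
    (C := C) (fun r => ae_nonneg_rescale hU _ r) hν (by linarith) ?_ ?_ ?_
    (continuousOn_timeRatio_neg_log hb1) ((measurable_timeRatio b).comp Real.measurable_log.neg)
  · have hconv : ∀ κ : Measure ℝ, (∀ᵐ t ∂κ, 0 ≤ t) →
        ∫ t, wt t * timeRatio b (-Real.log (Real.exp (-t))) ∂κ = ∫ t, timeKernel b t ∂κ := by
      intro κ hκ
      refine integral_congr_ae ?_
      filter_upwards [hκ] with t ht
      rw [Real.log_exp, neg_neg, wt_mul_timeRatio b ht]
    rw [hconv _ hν, integral_timeKernel (by linarith)] at key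
    simp_rw [fun r => hconv (μ r) (ae_nonneg_rescale hU _ r)] at key
    have hGpos : 0 < 4 ^ (b - 1) * Real.Gamma (b - 1) :=
      mul_pos (by positivity) (Real.Gamma_pos_of_pos (by linarith))
    rw [Asymptotics.isEquivalent_iff_exists_eq_mul]
    refine ⟨fun r => (∫ t, timeKernel b t ∂(μ r)) / (4 ^ (b - 1) * Real.Gamma (b - 1)), ?_, ?_⟩
    · have := key.div_const (4 ^ (b - 1) * Real.Gamma (b - 1))
      rwa [div_self hGpos.ne'] at this
    · filter_upwards [hq] with r hr
      obtain ⟨hr, hqr⟩ := hr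
      rw [toReal_greenRadial (by omega) hU hr]
      simp only [Pi.mul_apply]
      rw [integral_rescale U (by positivity) r (measurable_timeKernel b), ← hbd]
      have e1 : (4 * Real.pi) ^ (-(d : ℝ) / 2) = ((4 : ℝ) ^ (b - 1) * 4 * Real.pi ^ b)⁻¹ := by
        have : (4 : ℝ) ^ (b - 1) * 4 = 4 ^ b := by
          rw [← Real.rpow_add_one (by norm_num)]; ring_nf
        rw [this, neg_div, ← hbd, Real.rpow_neg (by positivity),
          Real.mul_rpow (by norm_num) Real.pi_pos.le]
      have e2 : r ^ (2 - (d : ℝ)) = r ^ 2 * r ^ (-(d : ℝ)) := by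
        rw [sub_eq_add_neg, Real.rpow_add hr]; norm_num
      have hG : Real.Gamma (b - 1) ≠ 0 := (Real.Gamma_pos_of_pos (by linarith)).ne'
      have h4 : (4 : ℝ) ^ (b - 1) ≠ 0 := by positivity
      have hp : Real.pi ^ b ≠ 0 := by positivity
      rw [e1, e2]
      field_simp
  · filter_upwards [hq, hb] with r hr hbr s hs
    rw [hlapμ r hr.1 hr.2 s hs]
    exact ENNReal.ofReal_le_ofReal (hbr s hs)
  · intro s hs
    rw [lap_volume hs]
    refine ENNReal.ofReal_le_ofReal ?_
    have : 0 < 1 / s := by positivity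
    nlinarith
  · intro s hs
    rw [lap_volume hs]
    refine (ENNReal.tendsto_ofReal (hlim s hs)).congr' ?_
    filter_upwards [hq] with r hr
    rw [hlapμ r hr.1 hr.2 s hs]

theorem one_div_mul_one_div_phi {r s q : ℝ} (hr : 0 < r) (hs : 0 < s) :
    1 / (r ^ 2 * q) * (1 / phi (s / r ^ 2)) =
      s / r ^ 2 * (1 / phi (s / r ^ 2)) / q * (1 / s) := by
  field_simp

theorem isEquivalent_greenRadial_atTop {d : ℕ} (hd : 3 ≤ d) {U : Measure ℝ} [SFinite U]
    (hU : ∀ᵐ t ∂U, 0 ≤ t) (hlap : ∀ s, 0 < s → lap U s = ENNReal.ofReal (1 / phi s)) :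
    Asymptotics.IsEquivalent atTop (fun r => (greenRadial d U r).toReal)
      (fun r => Real.Gamma ((d : ℝ) / 2 - 1) / (2 * Real.pi ^ ((d : ℝ) / 2)) *
        r ^ (2 - (d : ℝ))) := by
  have h := isEquivalent_greenRadial hd hU hlap (l := atTop) (q := fun _ => 2) (C := 1) ?_ le_rfl
    ?_ ?_
  · refine h.congr_right (Eventually.of_forall fun r => ?_)
    simp only
    ring
  · filter_upwards [eventually_gt_atTop 0] with r hr using ⟨hr, by norm_num⟩
  · filter_upwards [eventually_ge_atTop 1] with r hr s hs
    have hr0 : 0 < r := by linarith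
    rw [one_div_mul_one_div_phi hr0 hs]
    have h1 := mul_one_div_phi_le (show 0 < s / r ^ 2 by positivity)
    have h2 : s / r ^ 2 ≤ s := div_le_self hs.le (one_le_pow₀ hr)
    calc s / r ^ 2 * (1 / phi (s / r ^ 2)) / 2 * (1 / s) ≤ 2 * (1 + s) / 2 * (1 / s) := by
          have : s / r ^ 2 * (1 / phi (s / r ^ 2)) ≤ 2 * (1 + s) := by linarith
          gcongr
      _ = 1 * (1 + 1 / s) := by field_simp; ring
  · intro s hs
    have h1 : Tendsto (fun r : ℝ => s / r ^ 2) atTop (𝓝[>] 0) := by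
      refine tendsto_nhdsWithin_iff.2 ⟨?_, ?_⟩
      · exact tendsto_const_nhds.div_atTop (tendsto_pow_atTop two_ne_zero)
      · filter_upwards [eventually_gt_atTop 0] with r hr
        exact div_pos hs (pow_pos hr 2)
    have h2 := ((tendsto_mul_one_div_phi_zero.comp h1).div_const 2).mul_const (1 / s)
    rw [div_self two_ne_zero, one_mul] at h2
    refine h2.congr' ?_
    filter_upwards [eventually_gt_atTop 0] with r hr
    rw [one_div_mul_one_div_phi hr hs]
    rfl

theorem isEquivalent_greenRadial_zero {d : ℕ} (hd : 3 ≤ d) {U : Measure ℝ} [SFinite U]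
    (hU : ∀ᵐ t ∂U, 0 ≤ t) (hlap : ∀ s, 0 < s → lap U s = ENNReal.ofReal (1 / phi s)) :
    Asymptotics.IsEquivalent (𝓝[>] 0) (fun r => (greenRadial d U r).toReal)
      (fun r => Real.Gamma ((d : ℝ) / 2 - 1) / (2 * Real.pi ^ ((d : ℝ) / 2)) *
        r ^ (2 - (d : ℝ)) * Real.log (1 / r)) := by
  have hsmall : ∀ᶠ r : ℝ in 𝓝[>] 0, r ∈ Ioo (0 : ℝ) (1 / 2) :=
    Ioo_mem_nhdsGT (by norm_num)
  have hlog : ∀ r : ℝ, Real.log (1 / r ^ 2) = 2 * Real.log (1 / r) := by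
    intro r
    rw [one_div, one_div, Real.log_inv, Real.log_inv, Real.log_pow]
    push_cast
    ring
  have hl1 : ∀ r : ℝ, r ∈ Ioo (0 : ℝ) (1 / 2) → 1 ≤ 2 * Real.log (1 / r) := by
    intro r hr
    have : Real.log 2 ≤ Real.log (1 / r) := by
      refine Real.log_le_log (by norm_num) ?_
      rw [le_div_iff₀ hr.1]
      linarith [hr.2]
    linarith [Real.log_two_gt_d9]
  have h := isEquivalent_greenRadial hd hU hlap (l := 𝓝[>] 0)
    (q := fun r => 2 * Real.log (1 / r)) (C := 6) ?_ (by norm_num) ?_ ?_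
  · refine h.congr_right (Eventually.of_forall fun r => ?_)
    simp only
    ring
  · filter_upwards [hsmall] with r hr using ⟨hr.1, by linarith [hl1 r hr]⟩
  · filter_upwards [hsmall] with r hr s hs
    have hr0 : 0 < r := hr.1
    have hq := hl1 r hr
    rw [one_div_mul_one_div_phi hr0 hs]
    have h1 := mul_one_div_phi_le_log (show 0 < s / r ^ 2 by positivity)
    -- since `1 + s / r ^ 2 ≤ (1 + s) * (1 / r ^ 2)` for `r ≤ 1`
    have h2 : Real.log (1 + s / r ^ 2) ≤ s + 2 * Real.log (1 / r) := by
      rw [← hlog]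
      have hv : 1 ≤ 1 / r ^ 2 := by
        rw [le_div_iff₀ (by positivity)]
        nlinarith [hr.2]
      have h3 : 1 + s / r ^ 2 ≤ (1 + s) * (1 / r ^ 2) := by
        have : s / r ^ 2 = s * (1 / r ^ 2) := by ring
        rw [this]
        linarith
      have h4 := Real.log_le_log (by positivity) h3
      rw [Real.log_mul (by positivity) (by positivity)] at h4
      have h5 := Real.log_le_sub_one_of_pos (show 0 < 1 + s by linarith)
      have h6 := Real.log_nonneg hv
      linarith
    set q := 2 * Real.log (1 / r)
    calc s / r ^ 2 * (1 / phi (s / r ^ 2)) / q * (1 / s)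
        ≤ 6 * (1 + s) * q / q * (1 / s) := by
          have : s / r ^ 2 * (1 / phi (s / r ^ 2)) ≤ 6 * (1 + s) * q := by nlinarith
          gcongr
      _ = 6 * (1 + 1 / s) := by
          have : q ≠ 0 := by linarith
          field_simp
          ring
  · intro s hs
    have hv : Tendsto (fun r : ℝ => 1 / r ^ 2) (𝓝[>] 0) atTop := by
      have h1 := (tendsto_pow_atTop (α := ℝ) two_ne_zero).comp (tendsto_inv_nhdsGT_zero (𝕜 := ℝ))
      refine h1.congr (fun r => ?_)
      simp
    have h1 := (tendsto_one_div_phi_div_log.comp (hv.const_mul_atTop hs)).mul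
      ((tendsto_log_mul_div_log hs).comp hv)
    have h2 := h1.mul_const (1 / s)
    rw [one_mul, one_mul] at h2
    refine h2.congr' ?_
    filter_upwards [hsmall] with r hr
    have hr0 : 0 < r := hr.1
    have hq := hl1 r hr
    rw [one_div_mul_one_div_phi hr0 hs]
    have e : s * (1 / r ^ 2) = s / r ^ 2 := by ring
    have := log_one_add_pos (show 0 < s / r ^ 2 by positivity)
    simp only [Function.comp_apply, e, hlog]
    generalize Real.log (1 + s / r ^ 2) = L at *
    field_simp

/-! ### Evaluation of processes at random times -/

/-- The points of the grid `(n + 1)⁻¹ ℕ` other than `0`. -/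
def gridPoint (n k : ℕ) : ℝ≥0 := ((k : ℝ≥0) + 1) / ((n : ℝ≥0) + 1)

/-- The index of the first grid point strictly to the right of `s`. -/
def gridIndex (n : ℕ) (s : ℝ≥0) : ℕ := ⌊((n : ℝ≥0) + 1) * s⌋₊

/-- The smallest point of `(n + 1)⁻¹ ℕ` strictly to the right of `s`. -/
def discr (n : ℕ) (s : ℝ≥0) : ℝ≥0 := gridPoint n (gridIndex n s)

theorem measurable_gridIndex (n : ℕ) : Measurable (gridIndex n) :=
  Nat.measurable_floor.comp (measurable_const_mul _)

theorem le_discr (n : ℕ) (s : ℝ≥0) : s ≤ discr n s := by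
  rw [discr, gridPoint, gridIndex, le_div_iff₀ (by positivity), mul_comm]
  exact (Nat.lt_floor_add_one _).le

theorem discr_le (n : ℕ) (s : ℝ≥0) : discr n s ≤ s + 1 / ((n : ℝ≥0) + 1) := by
  have h : s + 1 / ((n : ℝ≥0) + 1) = (((n : ℝ≥0) + 1) * s + 1) / ((n : ℝ≥0) + 1) := by
    field_simp
  rw [discr, gridPoint, gridIndex, h]
  gcongr
  exact Nat.floor_le (by positivity)

theorem tendsto_discr (s : ℝ≥0) : Tendsto (fun n => discr n s) atTop (𝓝[≥] s) := by
  refine tendsto_nhdsWithin_iff.2 ⟨?_, Eventually.of_forall fun n => le_discr n s⟩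
  have h : Tendsto (fun n : ℕ => s + 1 / ((n : ℝ≥0) + 1)) atTop (𝓝 (s + 0)) :=
    tendsto_one_div_add_atTop_nhds_zero_nat.const_add s
  rw [add_zero] at h
  exact tendsto_of_tendsto_of_tendsto_of_le_of_le tendsto_const_nhds h
    (fun n => le_discr n s) (fun n => discr_le n s)

/-- A process with measurable coordinates and right-continuous paths, evaluated at a random time,
is a.e. measurable: it is the limit of its values at the discretized times. -/
theorem aemeasurable_eval {α Ω F : Type*} [MeasurableSpace α] [MeasurableSpace Ω]
    [TopologicalSpace F] [TopologicalSpace.PseudoMetrizableSpace F] [MeasurableSpace F]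
    [BorelSpace F] {κ : Measure α} {Y : ℝ≥0 → Ω → F} (hY : ∀ t, Measurable (Y t)) {π : α → Ω}
    (hπ : Measurable π) {τ : α → ℝ≥0} (hτ : AEMeasurable τ κ)
    (hc : ∀ᵐ a ∂κ, ∀ t, ContinuousWithinAt (fun s => Y s (π a)) (Ici t) t) :
    AEMeasurable (fun a => Y (τ a) (π a)) κ := by
  refine aemeasurable_of_tendsto_metrizable_ae atTop (f := fun n a => Y (discr n (τ a)) (π a))
    (fun n => ?_) ?_
  · have h1 : Measurable (fun q : ℕ × Ω => Y (gridPoint n q.1) q.2) :=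
      measurable_from_prod_countable_right fun k => hY (gridPoint n k)
    have h2 : AEMeasurable (fun a => (gridIndex n (τ a), π a)) κ :=
      ((measurable_gridIndex n).comp_aemeasurable hτ).prodMk hπ.aemeasurable
    have h3 := h1.comp_aemeasurable h2
    exact h3
  · filter_upwards [hc] with a ha
    exact (ha (τ a)).tendsto.comp (tendsto_discr _)

/-- Independence lets one freeze a discrete random time. -/
theorem lintegral_eval_nat_of_indepFun {Ω F : Type*} [MeasurableSpace Ω] [MeasurableSpace F]
    {P : Measure Ω} {Y : ℕ → Ω → F} (hY : ∀ k, Measurable (Y k)) {K : Ω → ℕ} (hK : Measurable K)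
    (hind : ∀ k, IndepFun (Y k) K P) {f : F → ℝ≥0∞} (hf : Measurable f) :
    ∫⁻ ω, f (Y (K ω) ω) ∂P = ∫⁻ ω, (∫⁻ ω', f (Y (K ω) ω') ∂P) ∂P := by
  have hsplit : ∀ (g : ℕ → ℝ≥0∞) (j : ℕ),
      g j = ∑' k, g k * ({k} : Set ℕ).indicator (fun _ => (1 : ℝ≥0∞)) j := by
    intro g j
    rw [tsum_eq_single j (fun k hk => by simp [hk.symm])]
    simp
  have hind1 : ∀ k, Measurable (fun ω => ({k} : Set ℕ).indicator (fun _ => (1 : ℝ≥0∞)) (K ω)) :=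
    fun k => (measurable_of_countable (({k} : Set ℕ).indicator fun _ => (1 : ℝ≥0∞))).comp hK
  have hfY : ∀ k, Measurable fun ω => f (Y k ω) := fun k => hf.comp (hY k)
  calc ∫⁻ ω, f (Y (K ω) ω) ∂P
      = ∫⁻ ω, ∑' k, f (Y k ω) * ({k} : Set ℕ).indicator (fun _ => (1 : ℝ≥0∞)) (K ω) ∂P :=
        lintegral_congr fun ω => hsplit (fun k => f (Y k ω)) (K ω)
    _ = ∑' k, ∫⁻ ω, f (Y k ω) * ({k} : Set ℕ).indicator (fun _ => (1 : ℝ≥0∞)) (K ω) ∂P :=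
        lintegral_tsum fun k => ((hfY k).mul (hind1 k)).aemeasurable
    _ = ∑' k, ∫⁻ ω, (∫⁻ ω', f (Y k ω') ∂P) *
          ({k} : Set ℕ).indicator (fun _ => (1 : ℝ≥0∞)) (K ω) ∂P := by
        refine tsum_congr fun k => ?_
        rw [lintegral_const_mul _ (hind1 k)]
        exact lintegral_mul_eq_lintegral_mul_lintegral_of_indepFun (hfY k) (hind1 k)
          ((hind k).comp hf
            (measurable_of_countable (({k} : Set ℕ).indicator fun _ => (1 : ℝ≥0∞))))
    _ = ∫⁻ ω, ∑' k, (∫⁻ ω', f (Y k ω') ∂P) *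
          ({k} : Set ℕ).indicator (fun _ => (1 : ℝ≥0∞)) (K ω) ∂P :=
        (lintegral_tsum fun k => ((hind1 k).const_mul _).aemeasurable).symm
    _ = ∫⁻ ω, (∫⁻ ω', f (Y (K ω) ω') ∂P) ∂P :=
        lintegral_congr fun ω => (hsplit (fun k => ∫⁻ ω', f (Y k ω') ∂P) (K ω)).symm

/-- Independence lets one freeze the random time at which a continuous process is evaluated. -/
theorem lintegral_eval_of_indepFun {Ω F : Type*} [MeasurableSpace Ω]
    [TopologicalSpace F] [MeasurableSpace F] [OpensMeasurableSpace F]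
    {P : Measure Ω} [IsProbabilityMeasure P] {Y : ℝ≥0 → Ω → F} (hY : ∀ t, Measurable (Y t))
    (hc : ∀ᵐ ω ∂P, Continuous fun s => Y s ω) {τ : Ω → ℝ≥0} (hτ : Measurable τ)
    (hind : ∀ t, IndepFun (Y t) τ P) (f : BoundedContinuousFunction F ℝ≥0) :
    ∫⁻ ω, f (Y (τ ω) ω) ∂P = ∫⁻ ω, (∫⁻ ω', f (Y (τ ω) ω') ∂P) ∂P := by
  have hfm : Measurable (fun y => (f y : ℝ≥0∞)) := by
    have := f.continuous.measurable
    fun_prop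
  have hbd : ∀ y, (f y : ℝ≥0∞) ≤ (nndist f 0 : ℝ≥0∞) := fun y => by
    exact_mod_cast BoundedContinuousFunction.NNReal.upper_bound f y
  have hle : ∀ s, ∫⁻ ω', (f (Y s ω') : ℝ≥0∞) ∂P ≤ (nndist f 0 : ℝ≥0∞) := fun s =>
    (lintegral_mono fun ω => hbd _).trans (by simp)
  have hfcont : Continuous fun y => (f y : ℝ≥0∞) :=
    ENNReal.continuous_coe.comp f.continuous
  have hd : ∀ n, ∫⁻ ω, f (Y (discr n (τ ω)) ω) ∂P =
      ∫⁻ ω, (∫⁻ ω', f (Y (discr n (τ ω)) ω') ∂P) ∂P := by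
    intro n
    simp only [discr]
    exact lintegral_eval_nat_of_indepFun (Y := fun k => Y (gridPoint n k))
      (K := fun ω => gridIndex n (τ ω)) (fun k => hY _)
      ((measurable_gridIndex n).comp hτ)
      (fun k => (hind _).comp measurable_id (measurable_gridIndex n))
      hfm
  have hlim : ∀ s, Tendsto (fun n => discr n s) atTop (𝓝 s) := fun s =>
    (tendsto_discr s).mono_right nhdsWithin_le_nhds
  have hk : ∀ n, Measurable (fun q : ℕ × Ω => Y (gridPoint n q.1) q.2) :=
    fun n => measurable_from_prod_countable_right fun k => hY (gridPoint n k)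
  have h1 : Tendsto (fun n => ∫⁻ ω, f (Y (discr n (τ ω)) ω) ∂P) atTop
      (𝓝 (∫⁻ ω, f (Y (τ ω) ω) ∂P)) := by
    refine tendsto_lintegral_of_dominated_convergence (fun _ => (nndist f 0 : ℝ≥0∞)) (fun n => ?_)
      (fun n => Eventually.of_forall fun ω => hbd _) (by simp) ?_
    · have h := hfm.comp ((hk n).comp (((measurable_gridIndex n).comp hτ).prodMk measurable_id))
      exact h
    · filter_upwards [hc] with ω hω
      exact ((hfcont.comp hω).tendsto _).comp (hlim _)
  have h2 : ∀ s, Tendsto (fun n => ∫⁻ ω', f (Y (discr n s) ω') ∂P) atTop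
      (𝓝 (∫⁻ ω', f (Y s ω') ∂P)) := by
    intro s
    refine tendsto_lintegral_of_dominated_convergence (fun _ => (nndist f 0 : ℝ≥0∞))
      (fun n => hfm.comp (hY _)) (fun n => Eventually.of_forall fun ω => hbd _) (by simp) ?_
    filter_upwards [hc] with ω hω
    exact ((hfcont.comp hω).tendsto _).comp (hlim _)
  have h3 : Tendsto (fun n => ∫⁻ ω, (∫⁻ ω', f (Y (discr n (τ ω)) ω') ∂P) ∂P) atTop
      (𝓝 (∫⁻ ω, (∫⁻ ω', f (Y (τ ω) ω') ∂P) ∂P)) := by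
    refine tendsto_lintegral_of_dominated_convergence (fun _ => (nndist f 0 : ℝ≥0∞)) (fun n => ?_)
      (fun n => Eventually.of_forall fun ω => hle _) (by simp)
      (Eventually.of_forall fun ω => h2 _)
    simp only [discr]
    have : Measurable fun k : ℕ => ∫⁻ ω', f (Y (gridPoint n k) ω') ∂P :=
      measurable_of_countable _
    have h := this.comp ((measurable_gridIndex n).comp hτ)
    exact h
  simp_rw [hd] at h1
  exact tendsto_nhds_unique h1 h3

/-! ### Gaussian laws in several dimensions -/

theorem lintegral_fintype_prod_eq_prod {ι : Type*} [Fintype ι] {E : ι → Type*}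
    {mE : ∀ i, MeasurableSpace (E i)} {μ : ∀ i, Measure (E i)} [∀ i, SigmaFinite (μ i)]
    {f : ∀ i, E i → ℝ} (hf : ∀ i, Integrable (f i) (μ i)) (h0 : ∀ i x, 0 ≤ f i x) :
    ∫⁻ x, ∏ i, ENNReal.ofReal (f i (x i)) ∂(Measure.pi μ) =
      ∏ i, ∫⁻ x, ENNReal.ofReal (f i x) ∂(μ i) := by
  have h1 : ∀ x : ∀ i, E i, ∏ i, ENNReal.ofReal (f i (x i)) = ENNReal.ofReal (∏ i, f i (x i)) :=
    fun x => (ENNReal.ofReal_prod_of_nonneg fun i _ => h0 i _).symm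
  simp_rw [h1, ← fun i => ofReal_integral_eq_lintegral_ofReal (hf i) (Eventually.of_forall (h0 i))]
  rw [← ENNReal.ofReal_prod_of_nonneg (fun i _ => integral_nonneg (h0 i)),
    ← integral_fintype_prod_eq_prod, ofReal_integral_eq_lintegral_ofReal
      (Integrable.fintype_prod_dep hf)
      (Eventually.of_forall fun x => Finset.prod_nonneg fun i _ => h0 i _)]

theorem pi_gaussianReal {ι : Type*} [Fintype ι] {v : ℝ≥0} (hv : v ≠ 0) :
    Measure.pi (fun _ : ι => gaussianReal 0 v) =
      (volume : Measure (ι → ℝ)).withDensity (fun x => ∏ i, gaussianPDF 0 v (x i)) := by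
  refine Measure.pi_eq fun s hs => ?_
  rw [withDensity_apply _ (MeasurableSet.univ_pi hs), volume_pi, Measure.restrict_pi_pi]
  simp_rw [gaussianPDF]
  rw [lintegral_fintype_prod_eq_prod (fun i => (integrable_gaussianPDFReal 0 v).integrableOn)
    (fun i x => gaussianPDFReal_nonneg 0 v x)]
  refine Finset.prod_congr rfl fun i _ => ?_
  rw [gaussianReal_apply _ hv]
  rfl

/-- The heat kernel `(4 π s)^{-d/2} e^{-r²/(4 s)}` of `ℝ^d`, at time `s` and distance `r`. -/
def heat (d : ℕ) (r s : ℝ) : ℝ≥0∞ := ENNReal.ofReal ((4 * Real.pi) ^ (-(d : ℝ) / 2)) *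
  ENNReal.ofReal (s ^ (-(d : ℝ) / 2) * Real.exp (-r ^ 2 / (4 * s)))

theorem measurable_heat (d : ℕ) {α : Type*} [MeasurableSpace α] {r s : α → ℝ} (hr : Measurable r)
    (hs : Measurable s) : Measurable fun a => heat d (r a) (s a) := by
  unfold heat; fun_prop

theorem prod_gaussianPDF {d : ℕ} {s : ℝ≥0} (hs : 0 < s) (y : E d) :
    ∏ i, gaussianPDF 0 (2 * s) (y i) = heat d ‖y‖ s := by
  have hs' : (0 : ℝ) < s := hs
  have h1 : ∏ i, gaussianPDFReal 0 (2 * s) (y i) = (4 * Real.pi) ^ (-(d : ℝ) / 2) *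
      ((s : ℝ) ^ (-(d : ℝ) / 2) * Real.exp (-‖y‖ ^ 2 / (4 * s))) := by
    simp_rw [gaussianPDFReal, sub_zero]
    rw [Finset.prod_mul_distrib, ← Real.exp_sum, Finset.prod_const, Finset.card_univ,
      Fintype.card_fin, ← mul_assoc]
    congr 1
    · rw [← Real.mul_rpow (by positivity) hs'.le]
      push_cast
      rw [show 2 * Real.pi * (2 * (s : ℝ)) = 4 * Real.pi * s by ring, Real.sqrt_eq_rpow,
        ← Real.rpow_neg (by positivity), ← Real.rpow_natCast, ← Real.rpow_mul (by positivity)]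
      congr 1
      ring
    · congr 1
      rw [EuclideanSpace.real_norm_sq_eq, ← Finset.sum_div, Finset.sum_neg_distrib]
      push_cast
      ring_nf
  simp_rw [gaussianPDF]
  rw [← ENNReal.ofReal_prod_of_nonneg (fun i _ => gaussianPDFReal_nonneg 0 _ _), h1, heat,
    ENNReal.ofReal_mul (by positivity)]

theorem IsBrownian.lintegral_eq {Ω : Type*} [MeasurableSpace Ω] {P : Measure Ω}
    [IsProbabilityMeasure P] {d : ℕ} {B : ℝ≥0 → Ω → E d} (hB : IsBrownian B P) {s : ℝ≥0}
    (hs : 0 < s) {f : E d → ℝ≥0∞} (hf : Measurable f) :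
    ∫⁻ ω, f (B s ω) ∂P = ∫⁻ y, heat d ‖y‖ s * f y := by
  have hcoord : ∀ i, Measurable fun ω => B s ω i := fun i => by
    have := hB.measurable s
    fun_prop
  have hlaw : ∀ i, P.map (fun ω => B s ω i) = gaussianReal 0 (2 * s) := by
    intro i
    have h := gaussianReal_const_mul ((hB.coord i).hasLaw_eval s) (Real.sqrt 2)
    have e1 : (fun ω => Real.sqrt 2 * ((Real.sqrt 2)⁻¹ * B s ω i)) = fun ω => B s ω i := by
      funext ω
      rw [← mul_assoc, mul_inv_cancel₀ (by positivity), one_mul]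
    have h2 := h.map_eq
    rw [e1] at h2
    rw [h2]
    congr 1
    · simp
    · ext
      simp
  have hind : iIndepFun (fun (i : Fin d) ω => B s ω i) P :=
    hB.indep.comp (fun _ p => p s) (fun _ => measurable_pi_apply s)
  have hpi := hind.map_fun_eq_pi_map (fun i => (hcoord i).aemeasurable)
  simp_rw [hlaw] at hpi
  rw [pi_gaussianReal (by positivity)] at hpi
  have hfm : Measurable fun x : Fin d → ℝ => f (WithLp.toLp 2 x) := by fun_prop
  have hpm : Measurable fun x : Fin d → ℝ => ∏ i, gaussianPDF 0 (2 * s) (x i) := by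
    have := measurable_gaussianPDF 0 (2 * s)
    fun_prop
  have hh : Measurable fun y : E d => heat d ‖y‖ s :=
    measurable_heat d measurable_norm measurable_const
  have hhf : Measurable fun y : E d => heat d ‖y‖ s * f y := hh.mul hf
  calc ∫⁻ ω, f (B s ω) ∂P = ∫⁻ x, f (WithLp.toLp 2 x) ∂(P.map fun ω i => B s ω i) := by
        rw [lintegral_map hfm (measurable_pi_lambda _ hcoord)]
    _ = ∫⁻ x : Fin d → ℝ, (∏ i, gaussianPDF 0 (2 * s) (x i)) * f (WithLp.toLp 2 x) := by
        rw [hpi, lintegral_withDensity_eq_lintegral_mul _ hpm hfm]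
        rfl
    _ = ∫⁻ x : Fin d → ℝ, heat d ‖(WithLp.toLp 2 x : E d)‖ s * f (WithLp.toLp 2 x) := by
        refine lintegral_congr fun x => ?_
        rw [← prod_gaussianPDF hs]
    _ = ∫⁻ y, heat d ‖y‖ s * f y := by
        exact (PiLp.volume_preserving_toLp (Fin d)).lintegral_comp hhf

theorem IsBrownian.continuous {Ω : Type*} [MeasurableSpace Ω] {P : Measure Ω} {d : ℕ}
    {B : ℝ≥0 → Ω → E d} (hB : IsBrownian B P) : ∀ᵐ ω ∂P, Continuous fun s => B s ω := by
  have h : ∀ᵐ ω ∂P, ∀ i, Continuous fun s => (Real.sqrt 2)⁻¹ * B s ω i :=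
    ae_all_iff.2 fun i => (hB.coord i).cont
  filter_upwards [h] with ω hω
  rw [← (PiLp.homeomorph 2 (fun _ : Fin d => ℝ)).comp_continuous_iff]
  refine continuous_pi fun i => ?_
  have h1 := (hω i).const_mul (Real.sqrt 2)
  refine h1.congr fun s => ?_
  rw [← mul_assoc, mul_inv_cancel₀ (by positivity), one_mul]
  rfl

/-! ### The subordinator and its potential measure -/

instance {Ω F : Type*} [MeasurableSpace Ω] [MeasurableSpace F] (Y : ℝ≥0 → Ω → F) (P : Measure Ω)
    [SFinite P] : SFinite (potentialMeasure Y P) := by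
  unfold potentialMeasure; infer_instance

theorem lintegral_potentialMeasure {Ω F : Type*} [MeasurableSpace Ω] [MeasurableSpace F]
    {Y : ℝ≥0 → Ω → F} {P : Measure Ω} [SFinite P]
    (hY : AEMeasurable (fun q : Ω × ℝ => Y q.2.toNNReal q.1)
      (P.prod (volume.restrict (Ioi (0 : ℝ))))) {h : F → ℝ≥0∞} (hh : Measurable h) :
    ∫⁻ y, h y ∂(potentialMeasure Y P) =
      ∫⁻ t in Ioi (0 : ℝ), ∫⁻ ω, h (Y t.toNNReal ω) ∂P := by
  rw [potentialMeasure, lintegral_map' hh.aemeasurable hY]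
  exact lintegral_prod_symm _ (hh.comp_aemeasurable hY)

section Subordinator

variable {Ω : Type*} [MeasurableSpace Ω] {P : Measure Ω} {S : ℝ≥0 → Ω → ℝ}

theorem IsSubordinator.aemeasurable_uncurry (hS : IsSubordinator S P) :
    AEMeasurable (fun q : Ω × ℝ => S q.2.toNNReal q.1)
      (P.prod (volume.restrict (Ioi (0 : ℝ)))) := by
  refine aemeasurable_eval (τ := fun q : Ω × ℝ => q.2.toNNReal) hS.measurable measurable_fst
    (by fun_prop) ?_
  refine Measure.quasiMeasurePreserving_fst.ae (p := fun ω =>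
    ∀ t, ContinuousWithinAt (fun s => S s ω) (Ici t) t) ?_
  filter_upwards [hS.cadlag] with ω hω t using (hω t).1

theorem IsSubordinator.ae_nonneg_potentialMeasure (hS : IsSubordinator S P) :
    ∀ᵐ s ∂(potentialMeasure S P), 0 ≤ s :=
  (ae_map_iff hS.aemeasurable_uncurry measurableSet_Ici).2
    (Eventually.of_forall fun _ => hS.nonneg _ _)

variable {d : ℕ} {B : ℝ≥0 → Ω → E d}

theorem aemeasurable_subordinate (hS : IsSubordinator S P) (hB : IsBrownian B P) (t : ℝ≥0) :
    AEMeasurable (subordinate B S t) P := by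
  refine aemeasurable_eval hB.measurable measurable_id
    (hS.measurable t).real_toNNReal.aemeasurable ?_
  filter_upwards [hB.continuous] with ω hω t using hω.continuousWithinAt

theorem aemeasurable_uncurry_subordinate (hS : IsSubordinator S P) (hB : IsBrownian B P) :
    AEMeasurable (fun q : Ω × ℝ => subordinate B S q.2.toNNReal q.1)
      (P.prod (volume.restrict (Ioi (0 : ℝ)))) := by
  refine aemeasurable_eval hB.measurable measurable_fst
    (measurable_real_toNNReal.comp_aemeasurable hS.aemeasurable_uncurry) ?_
  refine Measure.quasiMeasurePreserving_fst.ae (p := fun ω =>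
    ∀ t, ContinuousWithinAt (fun s => B s ω) (Ici t) t) ?_
  filter_upwards [hB.continuous] with ω hω t using hω.continuousWithinAt

theorem greenRadial_potentialMeasure (hd : 0 < d) (hS : IsSubordinator S P) (r : ℝ) :
    greenRadial d (potentialMeasure S P) r =
      ∫⁻ s, heat d r s ∂(potentialMeasure S P) := by
  rw [greenRadial_eq_lintegral hd hS.ae_nonneg_potentialMeasure]
  unfold heat
  rw [lintegral_const_mul' _ _ ENNReal.ofReal_ne_top]

variable [IsProbabilityMeasure P]

theorem HasLaplaceExponent.lintegral_eq (hphi : HasLaplaceExponent S P phi)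
    (hS : IsSubordinator S P) (t : ℝ≥0) {l : ℝ} (hl : 0 < l) :
    ∫⁻ ω, ENNReal.ofReal (Real.exp (-l * S t ω)) ∂P =
      ENNReal.ofReal (Real.exp (-(t : ℝ) * phi l)) := by
  rw [← hphi t l hl, ofReal_integral_eq_lintegral_ofReal _
    (Eventually.of_forall fun _ => Real.exp_nonneg _)]
  have := hS.measurable t
  refine Integrable.of_bound (by fun_prop) 1 (Eventually.of_forall fun ω => ?_)
  rw [Real.norm_eq_abs, Real.abs_exp, Real.exp_le_one_iff]
  have := mul_nonneg hl.le (hS.nonneg t ω)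
  linarith

/-- The Laplace transform of the potential measure is the reciprocal of the Laplace exponent. -/
theorem lap_potentialMeasure (hS : IsSubordinator S P) (hphi : HasLaplaceExponent S P phi) {l : ℝ}
    (hl : 0 < l) : lap (potentialMeasure S P) l = ENNReal.ofReal (1 / phi l) := by
  rw [lap, lintegral_potentialMeasure hS.aemeasurable_uncurry (by fun_prop),
    ← lap_volume (phi_pos hl), lap]
  refine setLIntegral_congr_fun measurableSet_Ioi fun t ht => ?_
  rw [hphi.lintegral_eq hS _ hl, Real.coe_toNNReal t (le_of_lt ht)]
  congr 2
  ring

theorem sqrt_le_phi {l : ℝ} (hl : 0 < l) : Real.sqrt l / 2 - 1 ≤ phi l := by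
  have h0 := log_one_add_pos hl
  have hs := Real.sqrt_pos.2 hl
  have h1 : Real.log (1 + l) ≤ 2 * Real.sqrt l := by
    have h2 : 1 + l ≤ (1 + Real.sqrt l) ^ 2 := by
      nlinarith [Real.sq_sqrt hl.le]
    have h3 := Real.log_le_log (by positivity) h2
    rw [Real.log_pow] at h3
    have h4 := Real.log_le_sub_one_of_pos (show 0 < 1 + Real.sqrt l by positivity)
    push_cast at h3
    linarith
  have h5 : Real.sqrt l / 2 ≤ l / Real.log (1 + l) := by
    rw [div_le_div_iff₀ two_pos h0]
    nlinarith [Real.sq_sqrt hl.le]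
  rw [phi]
  linarith

theorem tendsto_phi_atTop : Tendsto phi atTop atTop := by
  refine tendsto_atTop_mono' _ (f₁ := fun l => Real.sqrt l / 2 - 1) ?_ ?_
  · filter_upwards [eventually_gt_atTop 0] with l hl using sqrt_le_phi hl
  · exact tendsto_atTop_add_const_right _ _
      (Real.tendsto_sqrt_atTop.atTop_div_const two_pos)

/-- The subordinator is not a compound Poisson process: it leaves `0` immediately. -/
theorem ae_pos_of_hasLaplaceExponent (hS : IsSubordinator S P) (hphi : HasLaplaceExponent S P phi)
    {t : ℝ≥0} (ht : 0 < t) : ∀ᵐ ω ∂P, 0 < S t ω := by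
  have ht' : (0 : ℝ) < t := ht
  have hm : MeasurableSet {ω | S t ω = 0} := hS.measurable t (measurableSet_singleton 0)
  have hle : ∀ l : ℝ, 0 < l → P {ω | S t ω = 0} ≤
      ENNReal.ofReal (Real.exp (-(t : ℝ) * phi l)) := by
    intro l hl
    rw [← hphi.lintegral_eq hS t hl, ← lintegral_indicator_one hm]
    refine lintegral_mono fun ω => ?_
    by_cases h : S t ω = 0
    · simp [h]
    · simp [h]
  have hlim : Tendsto (fun l => ENNReal.ofReal (Real.exp (-(t : ℝ) * phi l))) atTop (𝓝 0) := by
    rw [← ENNReal.ofReal_zero]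
    refine ENNReal.tendsto_ofReal (Real.tendsto_exp_atBot.comp ?_)
    exact tendsto_phi_atTop.const_mul_atTop_of_neg (neg_lt_zero.2 ht')
  have h0 : P {ω | S t ω = 0} = 0 := by
    refine le_antisymm (ge_of_tendsto hlim ?_) zero_le
    filter_upwards [eventually_gt_atTop 0] with l hl using hle l hl
  have h1 : ∀ᵐ ω ∂P, S t ω ≠ 0 := by
    rw [ae_iff]
    simpa using h0
  filter_upwards [h1] with ω hω
  exact lt_of_le_of_ne (hS.nonneg t ω) hω.symm

/-- Negative moments of the subordinator are finite, since its Laplace exponent grows faster than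
any multiple of the logarithm. -/
theorem lintegral_rpow_neg_lt_top (hS : IsSubordinator S P) (hphi : HasLaplaceExponent S P phi)
    {t : ℝ≥0} (ht : 0 < t) {b : ℝ} (hb : 0 < b) :
    ∫⁻ ω, ENNReal.ofReal (S t ω ^ (-b)) ∂P < ∞ := by
  have ht' : (0 : ℝ) < t := ht
  have hG := Real.Gamma_pos_of_pos hb
  have hSm := hS.measurable t
  have hrep : ∀ s : ℝ, 0 < s → ENNReal.ofReal (s ^ (-b)) = ENNReal.ofReal (Real.Gamma b)⁻¹ *
      ∫⁻ l in Ioi (0 : ℝ), ENNReal.ofReal (l ^ (b - 1)) * ENNReal.ofReal (Real.exp (-l * s)) := by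
    intro s hs
    have h1 := Real.integral_rpow_mul_exp_neg_mul_Ioi hb hs
    have hi : IntegrableOn (fun l : ℝ => l ^ (b - 1) * Real.exp (-(s * l))) (Ioi 0) := by
      by_contra hcon
      rw [integral_undef hcon] at h1
      have : 0 < (1 / s) ^ b * Real.Gamma b := by positivity
      linarith
    have h2 : ∫⁻ l in Ioi (0 : ℝ), ENNReal.ofReal (l ^ (b - 1)) *
        ENNReal.ofReal (Real.exp (-l * s)) = ENNReal.ofReal ((1 / s) ^ b * Real.Gamma b) := by
      rw [← h1, ofReal_integral_eq_lintegral_ofReal hi]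
      · refine setLIntegral_congr_fun measurableSet_Ioi fun l hl => ?_
        have hl' : (0 : ℝ) < l := hl
        rw [← ENNReal.ofReal_mul (by positivity)]
        congr 3
        ring
      · filter_upwards [ae_restrict_mem measurableSet_Ioi] with l hl
        have hl' : (0 : ℝ) < l := hl
        simp only [Pi.zero_apply]
        positivity
    rw [h2, ← ENNReal.ofReal_mul (by positivity), one_div, Real.inv_rpow hs.le, ← Real.rpow_neg
      hs.le]
    congr 1
    field_simp
  have h1 : ∫⁻ ω, ENNReal.ofReal (S t ω ^ (-b)) ∂P = ENNReal.ofReal (Real.Gamma b)⁻¹ *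
      ∫⁻ l in Ioi (0 : ℝ), ENNReal.ofReal (l ^ (b - 1)) *
        ENNReal.ofReal (Real.exp (-(t : ℝ) * phi l)) := by
    calc ∫⁻ ω, ENNReal.ofReal (S t ω ^ (-b)) ∂P
        = ∫⁻ ω, ENNReal.ofReal (Real.Gamma b)⁻¹ * (∫⁻ l in Ioi (0 : ℝ),
            ENNReal.ofReal (l ^ (b - 1)) * ENNReal.ofReal (Real.exp (-l * S t ω))) ∂P := by
          refine lintegral_congr_ae ?_
          filter_upwards [ae_pos_of_hasLaplaceExponent hS hphi ht] with ω hω using hrep _ hω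
      _ = ENNReal.ofReal (Real.Gamma b)⁻¹ * ∫⁻ l in Ioi (0 : ℝ), ∫⁻ ω,
            ENNReal.ofReal (l ^ (b - 1)) * ENNReal.ofReal (Real.exp (-l * S t ω)) ∂P := by
          rw [lintegral_const_mul' _ _ ENNReal.ofReal_ne_top, lintegral_lintegral_swap]
          refine Measurable.aemeasurable ?_
          simp only [Function.uncurry_def]
          fun_prop
      _ = _ := by
          congr 1
          refine setLIntegral_congr_fun measurableSet_Ioi fun l hl => ?_
          rw [lintegral_const_mul' _ _ ENNReal.ofReal_ne_top, hphi.lintegral_eq hS t hl]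
  rw [h1]
  refine ENNReal.mul_lt_top ENNReal.ofReal_lt_top ?_
  have hi := (integrableOn_rpow_mul_exp_neg_mul_rpow (s := b - 1) (p := 1 / 2) (b := t / 2)
    (by linarith) (by norm_num) (by positivity)).const_mul (Real.exp t)
  refine lt_of_le_of_lt (setLIntegral_mono' measurableSet_Ioi fun l hl => ?_) hi.lintegral_lt_top
  have hl' : (0 : ℝ) < l := hl
  rw [← ENNReal.ofReal_mul (by positivity)]
  refine ENNReal.ofReal_le_ofReal ?_
  have h2 : Real.exp (-(t : ℝ) * phi l) ≤ Real.exp t * Real.exp (-(t / 2) * l ^ (1 / 2 : ℝ)) := by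
    rw [← Real.exp_add, Real.exp_le_exp, ← Real.sqrt_eq_rpow]
    have := mul_le_mul_of_nonneg_left (sqrt_le_phi hl') ht'.le
    linarith
  calc l ^ (b - 1) * Real.exp (-(t : ℝ) * phi l)
      ≤ l ^ (b - 1) * (Real.exp t * Real.exp (-(t / 2) * l ^ (1 / 2 : ℝ))) := by gcongr
    _ = _ := by ring

/-! ### Transition density and Green function -/

theorem heat_le_heat_zero (d : ℕ) (r : ℝ) {s : ℝ} (hs : 0 ≤ s) : heat d r s ≤ heat d 0 s := by
  unfold heat
  have h : -r ^ 2 / (4 * s) ≤ -(0 : ℝ) ^ 2 / (4 * s) := by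
    gcongr ?_ / _
    simpa using sq_nonneg r
  gcongr

theorem continuous_heat (d : ℕ) (s : ℝ) : Continuous fun r => heat d r s := by
  unfold heat
  exact ENNReal.continuous_const_mul ENNReal.ofReal_ne_top |>.comp
    (ENNReal.continuous_ofReal.comp (by fun_prop))

/-- The transition density of the subordinate process at distance `r`: the heat kernel averaged
over the random time `S t`. -/
def density (d : ℕ) (S : ℝ≥0 → Ω → ℝ) (P : Measure Ω) (t : ℝ≥0) (r : ℝ) : ℝ≥0∞ :=
  ∫⁻ ω, heat d r (S t ω) ∂P

theorem density_zero_lt_top (hd : 0 < d) (hS : IsSubordinator S P)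
    (hphi : HasLaplaceExponent S P phi) {t : ℝ≥0} (ht : 0 < t) : density d S P t 0 < ∞ := by
  have hb : (0 : ℝ) < (d : ℝ) / 2 := by positivity
  have h := lintegral_rpow_neg_lt_top hS hphi ht hb
  unfold density heat
  rw [lintegral_const_mul' _ _ ENNReal.ofReal_ne_top]
  refine ENNReal.mul_lt_top ENNReal.ofReal_lt_top ?_
  simpa [neg_div] using h

theorem density_lt_top (hd : 0 < d) (hS : IsSubordinator S P)
    (hphi : HasLaplaceExponent S P phi) {t : ℝ≥0} (ht : 0 < t) (r : ℝ) :
    density d S P t r < ∞ :=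
  (lintegral_mono fun ω => heat_le_heat_zero d r (hS.nonneg t ω)).trans_lt
    (density_zero_lt_top hd hS hphi ht)

theorem continuous_density (hd : 0 < d) (hS : IsSubordinator S P)
    (hphi : HasLaplaceExponent S P phi) {t : ℝ≥0} (ht : 0 < t) :
    Continuous (density d S P t) := by
  rw [continuous_iff_continuousAt]
  intro r
  refine tendsto_lintegral_filter_of_dominated_convergence (fun ω => heat d 0 (S t ω)) ?_ ?_
    (density_zero_lt_top hd hS hphi ht).ne ?_
  · exact Eventually.of_forall fun r =>
      measurable_heat d measurable_const (hS.measurable t)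
  · exact Eventually.of_forall fun r => Eventually.of_forall fun ω =>
      heat_le_heat_zero d r (hS.nonneg t ω)
  · exact Eventually.of_forall fun ω => (continuous_heat d _).continuousAt

theorem map_add_subordinate (hS : IsSubordinator S P)
    (hphi : HasLaplaceExponent S P phi) (hB : IsBrownian B P)
    (hBS : IndepFun (fun (ω : Ω) (t : ℝ≥0) => B t ω) (fun (ω : Ω) (t : ℝ≥0) => S t ω) P)
    {t : ℝ≥0} (ht : 0 < t) (x : E d) :
    P.map (fun ω => x + subordinate B S t ω) =
      volume.withDensity fun y => density d S P t ‖x - y‖ := by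
  have hSm := hS.measurable t
  have hX := aemeasurable_subordinate hS hB t
  have hheat : Measurable fun q : Ω × E d => heat d ‖x - q.2‖ (S t q.1) :=
    measurable_heat d (by fun_prop) (by fun_prop)
  have hdens : Measurable fun y : E d => density d S P t ‖x - y‖ := by
    unfold density
    exact hheat.lintegral_prod_left'
  refine ext_of_forall_lintegral_eq_of_IsFiniteMeasure fun f => ?_
  have hf : Measurable fun y => (f y : ℝ≥0∞) := by
    have := f.continuous.measurable
    fun_prop
  let fx : BoundedContinuousFunction (E d) ℝ≥0 := f.compContinuous ⟨fun y => x + y, by fun_prop⟩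
  have hfx : Measurable fun y => (fx y : ℝ≥0∞) := by
    have := fx.continuous.measurable
    fun_prop
  have hind : ∀ s, IndepFun (B s) (fun ω => (S t ω).toNNReal) P := fun s =>
    hBS.comp (φ := fun p : ℝ≥0 → E d => p s) (ψ := fun p : ℝ≥0 → ℝ => (p t).toNNReal)
      (measurable_pi_apply s) (measurable_pi_apply t).real_toNNReal
  calc ∫⁻ y, f y ∂(P.map fun ω => x + subordinate B S t ω)
      = ∫⁻ ω, fx (B (S t ω).toNNReal ω) ∂P := by
        rw [lintegral_map' hf.aemeasurable (hX.const_add x)]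
        rfl
    _ = ∫⁻ ω, (∫⁻ ω', fx (B (S t ω).toNNReal ω') ∂P) ∂P :=
        lintegral_eval_of_indepFun hB.measurable hB.continuous hSm.real_toNNReal hind fx
    _ = ∫⁻ ω, (∫⁻ y, heat d ‖x - y‖ (S t ω) * f y) ∂P := by
        refine lintegral_congr_ae ?_
        filter_upwards [ae_pos_of_hasLaplaceExponent hS hphi ht] with ω hω
        rw [hB.lintegral_eq (Real.toNNReal_pos.2 hω) hfx, Real.coe_toNNReal _ hω.le,
          ← lintegral_add_left_eq_self (fun y => heat d ‖x - y‖ (S t ω) * f y) x]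
        refine lintegral_congr fun y => ?_
        rw [sub_add_cancel_left, norm_neg]
        rfl
    _ = ∫⁻ y, (∫⁻ ω, heat d ‖x - y‖ (S t ω) * f y ∂P) := by
        refine lintegral_lintegral_swap (Measurable.aemeasurable ?_)
        exact hheat.mul (hf.comp measurable_snd)
    _ = ∫⁻ y, f y ∂(volume.withDensity fun y => density d S P t ‖x - y‖) := by
        rw [lintegral_withDensity_eq_lintegral_mul _ hdens hf]
        refine lintegral_congr fun y => ?_
        rw [lintegral_mul_const' _ _ ENNReal.coe_ne_top]
        rfl

theorem greenRadial_eq_lintegral_density (hd : 0 < d) (hS : IsSubordinator S P) (r : ℝ) :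
    greenRadial d (potentialMeasure S P) r =
      ∫⁻ t in Ioi (0 : ℝ), density d S P t.toNNReal r := by
  rw [greenRadial_potentialMeasure hd hS, lintegral_potentialMeasure hS.aemeasurable_uncurry
    (measurable_heat d measurable_const measurable_id')]
  rfl

theorem isGreenFunction_greenRadial (hd : 0 < d) (hS : IsSubordinator S P)
    (hphi : HasLaplaceExponent S P phi) (hB : IsBrownian B P)
    (hBS : IndepFun (fun (ω : Ω) (t : ℝ≥0) => B t ω) (fun (ω : Ω) (t : ℝ≥0) => S t ω) P) :
    IsGreenFunction (subordinate B S) P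
      (fun x y => greenRadial d (potentialMeasure S P) ‖x - y‖) := by
  refine ⟨⟨fun t x y => (density d S P t ‖x - y‖).toNNReal, fun t ht x => ⟨?_, ?_⟩,
    fun x y => ?_⟩, fun x => ?_⟩
  · refine continuous_iff_continuousAt.2 fun y => ?_
    have h1 : ContinuousAt (fun y => density d S P t ‖x - y‖) y :=
      ((continuous_density hd hS hphi ht).comp (by fun_prop)).continuousAt
    exact (ENNReal.tendsto_toNNReal (density_lt_top hd hS hphi ht _).ne).comp h1
  · rw [map_add_subordinate hS hphi hB hBS ht]
    congr 1
    funext y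
    rw [ENNReal.coe_toNNReal (density_lt_top hd hS hphi ht _).ne]
  · refine (greenRadial_eq_lintegral_density hd hS _).trans ?_
    refine setLIntegral_congr_fun measurableSet_Ioi fun t ht => ?_
    simp only
    rw [ENNReal.coe_toNNReal (density_lt_top hd hS hphi (Real.toNNReal_pos.2 ht) _).ne]
  · have hheat : Measurable fun q : ℝ × E d => heat d ‖x - q.2‖ q.1 :=
      measurable_heat d (by fun_prop) (by fun_prop)
    ext A hA
    have hind : Measurable (A.indicator (1 : E d → ℝ≥0∞)) := measurable_one.indicator hA
    rw [withDensity_apply _ hA, ← lintegral_indicator_one hA,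
      lintegral_potentialMeasure ((aemeasurable_uncurry_subordinate hS hB).const_add x) hind]
    calc ∫⁻ t in Ioi (0 : ℝ), ∫⁻ ω, A.indicator 1 (x + subordinate B S t.toNNReal ω) ∂P
        = ∫⁻ t in Ioi (0 : ℝ), ∫⁻ ω, (∫⁻ y in A, heat d ‖x - y‖ (S t.toNNReal ω)) ∂P := by
          refine setLIntegral_congr_fun measurableSet_Ioi fun t ht => ?_
          have ht' : 0 < t.toNNReal := Real.toNNReal_pos.2 ht
          have hheat' : Measurable fun q : Ω × E d => heat d ‖x - q.2‖ (S t.toNNReal q.1) := by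
            have := hS.measurable t.toNNReal
            exact measurable_heat d (by fun_prop) (by fun_prop)
          rw [← lintegral_map' (f := A.indicator 1) hind.aemeasurable
            ((aemeasurable_subordinate hS hB _).const_add x),
            map_add_subordinate hS hphi hB hBS ht', lintegral_indicator_one hA,
            withDensity_apply _ hA]
          exact lintegral_lintegral_swap (hheat'.comp measurable_swap).aemeasurable
      _ = ∫⁻ s, (∫⁻ y in A, heat d ‖x - y‖ s) ∂(potentialMeasure S P) :=
          (lintegral_potentialMeasure hS.aemeasurable_uncurry hheat.lintegral_prod_right').symm
      _ = ∫⁻ y in A, (∫⁻ s, heat d ‖x - y‖ s ∂(potentialMeasure S P)) :=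
          lintegral_lintegral_swap hheat.aemeasurable
      _ = ∫⁻ y in A, greenRadial d (potentialMeasure S P) ‖x - y‖ :=
          lintegral_congr fun y => (greenRadial_potentialMeasure hd hS _).symm

end Subordinator

end GreenAsymp

end

theorem mainTheorem4 (d : ℕ) (hd : 3 ≤ d) {Ω : Type*} [MeasurableSpace Ω]
    (P : Measure Ω) [IsProbabilityMeasure P]
    (S : ℝ≥0 → Ω → ℝ) (hS : GreenAsymp.IsSubordinator S P)
    (hphi : GreenAsymp.HasLaplaceExponent S P GreenAsymp.phi)
    (B : ℝ≥0 → Ω → GreenAsymp.E d) (hB : GreenAsymp.IsBrownian B P)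
    (hBS : IndepFun (fun (ω : Ω) (t : ℝ≥0) => B t ω) (fun (ω : Ω) (t : ℝ≥0) => S t ω) P)
    (X : ℝ≥0 → Ω → GreenAsymp.E d) (hX : X = GreenAsymp.subordinate B S)
    (g : ℝ → ℝ≥0∞)
    (hg : g = GreenAsymp.greenRadial d (GreenAsymp.potentialMeasure S P)) :
    GreenAsymp.IsGreenFunction X P (fun x y => g ‖x - y‖) ∧
    (∀ r : ℝ, 0 < r → g r < ∞) ∧
    Asymptotics.IsEquivalent (𝓝[>] (0 : ℝ)) (fun r => (g r).toReal)
      (fun r => Real.Gamma ((d : ℝ) / 2 - 1) / (2 * Real.pi ^ ((d : ℝ) / 2)) *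
        r ^ (2 - (d : ℝ)) * Real.log (1 / r)) ∧
    Asymptotics.IsEquivalent atTop (fun r => (g r).toReal)
      (fun r => Real.Gamma ((d : ℝ) / 2 - 1) / (2 * Real.pi ^ ((d : ℝ) / 2)) *
        r ^ (2 - (d : ℝ))) := by
  subst hX hg
  have hU := hS.ae_nonneg_potentialMeasure
  have hlap : ∀ s, 0 < s → GreenAsymp.lap (GreenAsymp.potentialMeasure S P) s =
      ENNReal.ofReal (1 / GreenAsymp.phi s) :=
    fun s hs => GreenAsymp.lap_potentialMeasure hS hphi hs
  exact ⟨GreenAsymp.isGreenFunction_greenRadial (by omega) hS hphi hB hBS,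
    fun r hr => GreenAsymp.greenRadial_lt_top hd hU hlap hr,
    GreenAsymp.isEquivalent_greenRadial_zero hd hU hlap,
    GreenAsymp.isEquivalent_greenRadial_atTop hd hU hlap⟩
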